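/- Let $A=(t_n)_{n\ge 1}$ be any sequence of non-negative integers that dilates to infinity, that is, $\lim_{n\to\infty}(t_{n+1}-t_n)=+\infty$. Then there is a rank one measure-preserving system $(X,\mathcal B,\mu,T)$, where $(X,\mathcal B)$ is a standard Borel space, $\mu$ is a probability measure and $T$ is an invertible measure-preserving transformation, such that $h^A(T)=+\infty$. Here the sequence entropy is \[h^A(T)=\sup_{\xi}\ \limsup_{n\to\infty}\frac1n H\Big(\bigvee_{k=1}^{n}T^{-t_k}\xi\Big),\] the supremum being over all finite measurable partitions $\xi$ of $X$, where $H(\{X_1,\dots,X_m\})=-\sum_{i=1}^m\mu(X_i)\log\mu(X_i)$ with $0\log 0=0$. The system is of rank one if it arises by cutting and stacking: there are integers $q_n\ge 1$ and $a_{n,i}\ge 0$ ($n\ge 0$, $1\le i\le q_n-1$) such that, with $a_n=\sum_{i=1}^{q_n-1}a_{n,i}$, $h_0=1$ and $h_{n+1}=q_nh_n+a_n$, the sum $\sum_n a_n/h_{n+1}$ converges, and there are measurable sets $F_n$, $F_{n,i}$ ($1\le i\le q_n$) and $C_{n,i,j}$ ($1\le i\le q_n-1$, $1\le j\le a_{n,i}$)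 such that for every $n\ge 0$: (a) the levels $F_n,TF_n,\dots,T^{h_n-1}F_n$ are pairwise disjoint; (b) $F_{n,1},\dots,F_{n,q_n}$ partition $F_n$; (c) for $1\le i\le q_n-1$, $T^{h_n}F_{n,i}=C_{n,i,1}$ if $a_{n,i}>0$ and $T^{h_n}F_{n,i}=F_{n,i+1}$ if $a_{n,i}=0$; (d) for $1\le i\le q_n-1$, $TC_{n,i,j}=C_{n,i,j+1}$ if $1\le j<a_{n,i}$ and $TC_{n,i,j}=F_{n,i+1}$ if $j=a_{n,i}$; (e) $F_{n+1}=F_{n,1}$; and moreover the towers $\bigcup_{k=0}^{h_n-1}T^kF_n$ exhaust $X$ up to a $\mu$-null set, and the partitions $\{F_n,TF_n,\dots,T^{h_n-1}F_n,X\setminus\bigcup_{k=0}^{h_n-1}T^kF_n\}$ approach the point partition, i.e. the $\sigma$-algebra generated by all levels of all towers equals $\mathcal B$ up to $\mu$-null sets. -/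

import Mathlib

open MeasureTheory Filter

noncomputable section

/-- The sequence `t` of non-negative integers dilates to infinity:
`t (n + 1) - t n → +∞` (the difference is taken in `ℤ`). -/
def DilatesToInfinity (t : ℕ → ℕ) : Prop :=
  Tendsto (fun n => (t (n + 1) : ℤ) - (t n : ℤ)) atTop atTop

/-- Total number of spacer levels `∑_{i < q - 1} a i` inserted between the `q` consecutive columns
of a tower (columns are numbered from `0`; `a i` spacers go between columns `i` and `i + 1`). -/
def spacerTotal (q : ℕ) (a : ℕ → ℕ) : ℕ :=
  ∑ i ∈ Finset.range (q - 1), a i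

/-- Tower heights: `h 0 = 1` and `h (n + 1) = q n * h n + ∑_i a n i`. -/
def towerHeight (q : ℕ → ℕ) (a : ℕ → ℕ → ℕ) : ℕ → ℕ
  | 0 => 1
  | n + 1 => q n * towerHeight q a n + spacerTotal (q n) (a n)

/-- The constructive geometric (cut-and-stack) description of a rank one system `(X, μ, T)`, with
stacking data `q n`, `a n i`, tower bases `F n`, their cuts `Fc n i` for `i < q n`, and spacer
levels `C n i j` for `i + 1 < q n`, `j < a n i`. -/
structure IsCutAndStack {X : Type*} [MeasurableSpace X] (μ : Measure X) (T : X ≃ᵐ X)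
    (q : ℕ → ℕ) (a : ℕ → ℕ → ℕ) (F : ℕ → Set X) (Fc : ℕ → ℕ → Set X)
    (C : ℕ → ℕ → ℕ → Set X) : Prop where
  one_le_q : ∀ n, 1 ≤ q n
  summable_spacers :
    Summable fun n => (spacerTotal (q n) (a n) : ℝ) / (towerHeight q a (n + 1) : ℝ)
  measurableSet_base : ∀ n, MeasurableSet (F n)
  measurableSet_cut : ∀ n i, i < q n → MeasurableSet (Fc n i)
  measurableSet_spacer : ∀ n i j, i + 1 < q n → j < a n i → MeasurableSet (C n i j)
  /-- the levels `F n, T (F n), …, T^(h n - 1) (F n)` are pairwise disjoint -/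
  disjoint_levels : ∀ n k l, k < towerHeight q a n → l < towerHeight q a n → k ≠ l →
    Disjoint (T^[k] '' F n) (T^[l] '' F n)
  /-- the cuts `Fc n 0, …, Fc n (q n - 1)` partition the base `F n` -/
  disjoint_cuts : ∀ n i j, i < q n → j < q n → i ≠ j → Disjoint (Fc n i) (Fc n j)
  iUnion_cuts : ∀ n, ⋃ i ∈ Finset.range (q n), Fc n i = F n
  /-- above the top level of a column comes the next column, or a spacer -/
  image_top : ∀ n i, i + 1 < q n →
    T^[towerHeight q a n] '' Fc n i = if a n i = 0 then Fc n (i + 1) else C n i 0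
  /-- above a spacer comes the next spacer, or the next column after the last spacer -/
  image_spacer : ∀ n i j, i + 1 < q n → j < a n i →
    T '' C n i j = if j + 1 = a n i then Fc n (i + 1) else C n i (j + 1)
  base_succ : ∀ n, F (n + 1) = Fc n 0
  /-- the towers exhaust the space up to a null set -/
  exhaust : μ (⋃ n, ⋃ k ∈ Finset.range (towerHeight q a n), T^[k] '' F n)ᶜ = 0
  /-- the partitions into levels approach the point partition: up to null sets, the levels of all
  the towers generate the `σ`-algebra of measurable sets -/
  generate : ∀ B : Set X, MeasurableSet B →
    ∃ B' : Set X,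
      MeasurableSet[MeasurableSpace.generateFrom
        {L : Set X | ∃ n k, k < towerHeight q a n ∧ L = T^[k] '' F n}] B' ∧
      B =ᵐ[μ] B'

/-- The invertible measure-preserving system `(X, μ, T)` is of rank one. -/
def IsRankOne {X : Type*} [MeasurableSpace X] (μ : Measure X) (T : X ≃ᵐ X) : Prop :=
  MeasurePreserving T μ μ ∧ ∃ q a F Fc C, IsCutAndStack μ T q a F Fc C

/-- Shannon entropy of the finite partition `{φ⁻¹ {i}}` given by a coding function `φ`. -/
def shannonEntropy {X : Type*} [MeasurableSpace X] (μ : Measure X) {ι : Type*} [Fintype ι]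
    (φ : X → ι) : ℝ :=
  ∑ i, Real.negMulLog (μ.real (φ ⁻¹' {i}))

/-- The coding function of the join `⋁_{k < n} T^{-t k} ξ`, where `ξ` is the partition with coding
function `φ`: a point is sent to its word `φ (T^(t 0) x), …, φ (T^(t (n - 1)) x)`. -/
def sequenceCoding {X : Type*} (T : X → X) (t : ℕ → ℕ) {ι : Type*} (φ : X → ι) (n : ℕ) :
    X → (Fin n → ι) :=
  fun x k => φ (T^[t k] x)

/-- Sequence entropy of `T` along `t` with respect to the finite partition coded by `φ`:
`limsup_n (1 / n) H(⋁_{k < n} T^{-t k} ξ)`. -/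
def sequenceEntropyOf {X : Type*} [MeasurableSpace X] (μ : Measure X) (T : X → X) (t : ℕ → ℕ)
    {m : ℕ} (φ : X → Fin m) : EReal :=
  limsup (fun n : ℕ => ((1 / (n : ℝ) * shannonEntropy μ (sequenceCoding T t φ n) : ℝ) : EReal))
    atTop

/-- Sequence entropy of `T` along `t`: the supremum of `sequenceEntropyOf` over all finite
measurable partitions, each given by a measurable coding function. -/
def sequenceEntropy {X : Type*} [MeasurableSpace X] (μ : Measure X) (T : X → X) (t : ℕ → ℕ) :
    EReal :=
  ⨆ (m : ℕ) (φ : X → Fin m) (_ : Measurable φ), sequenceEntropyOf μ T t φ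

end

/-!
The system is built by cutting and stacking with spacers that imitate independent random
variables, and is realized as a skyscraper over the 2-adic odometer.

*The system.* If the `n`-th tower is cut into `2 ^ b n` columns, the induced map on the base of
the first tower is `z ↦ z + 1` on `ℤ₂` with Haar measure, and the bases of the towers are the
subgroups `2 ^ expo b n ℤ₂`. The spacers are additional floors over the base levels that end a
column (`Odometer.spacersAbove`); the skyscraper transformation preserves the measure
(`Skyscraper.measurePreserving_step`), its total mass is finite as soon as the spacers are
summable, and its levels separate points, hence generate the `σ`-algebra. This yields a rank one
system for all summable spacers (`Odometer.exists_isCutAndStack`).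

*The choice of spacers.* Let `h` be the height of the `n`-th tower. Its columns are grouped into
blocks of `L` columns, with spacers only after each block, `R ≈ h` different numbers of them, and
`L` so large that the spacers are summable. The blocks are grouped into superblocks of `M` blocks,
one for each of the `R ^ M` possible sequences of spacer numbers (`digitSpacers`). So a point that
is uniformly distributed in the tower sees independent and uniformly distributed numbers of
spacers until it leaves its superblock.

*The entropy.* Fix `m` and code points by the levels of the `m`-th tower, of height `h_m`, with
one more symbol for its complement. From some index `k₀` on, the gaps of `t` exceed two block
lengths, so that between two of these times there is a full run of random spacers. It shifts the
position at the later time through a window of length `R ≤ h`, which shows each level of the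
`n`-th tower at most twice. Hence, given the symbols at the earlier times after `k₀`, each level
of the `m`-th tower is seen with probability at most `8 / h_m` (`tailBound`,
`IsCutAndStack.window_le`). By Markov's inequality most points spend at least half of the times
`t k`, `k < 4 * N`, in the `m`-th tower, so the names of most points have probability at most
`(8 / h_m) ^ N` (`IsCutAndStack.measureReal_name_le`), and the entropy along these `4 * N` times is at
least `N / 2 * log (h_m / 16)` (`IsCutAndStack.le_shannonEntropy_of_isStage`). Since this happens
at every stage `n ≥ m`, with `N → ∞`, the sequence entropy is at least `log (h_m / 16) / 8` for
every large `m`.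
-/

open MeasureTheory Filter

noncomputable section

/-! ### Skyscrapers over a measure-preserving automorphism -/

/-- The skyscraper over `Ω` with `ρ z` additional floors above the point `z`; the point `(z, j)` is
the `j`-th floor above `z`, floor `0` being the base. -/
abbrev Skyscraper {Ω : Type} (ρ : Ω → ℕ) : Type := {x : Ω × ℕ // x.2 ≤ ρ x.1}

namespace Skyscraper

variable {Ω : Type} [MeasurableSpace Ω] {ρ : Ω → ℕ}

/-- Climb one floor, and go from the top floor above `z` to the base point `S z`. -/
def stepFun (S : Ω ≃ᵐ Ω) (ρ : Ω → ℕ) (x : Skyscraper ρ) : Skyscraper ρ :=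
  if h : x.1.2 + 1 ≤ ρ x.1.1 then ⟨(x.1.1, x.1.2 + 1), h⟩ else ⟨(S x.1.1, 0), Nat.zero_le _⟩

/-- The inverse of `stepFun`. -/
def stepInv (S : Ω ≃ᵐ Ω) (ρ : Ω → ℕ) (x : Skyscraper ρ) : Skyscraper ρ :=
  if x.1.2 = 0 then ⟨(S.symm x.1.1, ρ (S.symm x.1.1)), le_rfl⟩
  else ⟨(x.1.1, x.1.2 - 1), (Nat.sub_le _ _).trans x.2⟩

lemma measurableSet_carrier (hρ : Measurable ρ) : MeasurableSet {x : Ω × ℕ | x.2 ≤ ρ x.1} :=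
  measurableSet_le measurable_snd (hρ.comp measurable_fst)

lemma measurableEmbedding_val (hρ : Measurable ρ) :
    MeasurableEmbedding (Subtype.val : Skyscraper ρ → Ω × ℕ) :=
  MeasurableEmbedding.subtype_coe (measurableSet_carrier hρ)

lemma measurable_stepFun (S : Ω ≃ᵐ Ω) (hρ : Measurable ρ) : Measurable (stepFun S ρ) := by
  have h1 : Measurable fun x : Skyscraper ρ => x.1.1 := measurable_fst.comp measurable_subtype_coe
  have h2 : Measurable fun x : Skyscraper ρ => x.1.2 := measurable_snd.comp measurable_subtype_coe
  have h3 : (fun x => (stepFun S ρ x).1) = fun x : Skyscraper ρ =>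
      if x.1.2 + 1 ≤ ρ x.1.1 then (x.1.1, x.1.2 + 1) else (S x.1.1, 0) := by
    funext x
    unfold stepFun
    split_ifs <;> rfl
  refine (measurableEmbedding_val hρ).measurable_comp_iff.1 ?_
  rw [show Subtype.val ∘ stepFun S ρ = fun x => (stepFun S ρ x).1 from rfl, h3]
  refine Measurable.ite (measurableSet_le (h2.add_const 1) (hρ.comp h1)) ?_ ?_
  · exact h1.prodMk (h2.add_const 1)
  · exact (S.measurable.comp h1).prodMk measurable_const

lemma measurable_stepInv (S : Ω ≃ᵐ Ω) (hρ : Measurable ρ) : Measurable (stepInv S ρ) := by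
  have h1 : Measurable fun x : Skyscraper ρ => x.1.1 := measurable_fst.comp measurable_subtype_coe
  have h2 : Measurable fun x : Skyscraper ρ => x.1.2 := measurable_snd.comp measurable_subtype_coe
  have h3 : (fun x => (stepInv S ρ x).1) = fun x : Skyscraper ρ =>
      if x.1.2 = 0 then (S.symm x.1.1, ρ (S.symm x.1.1)) else (x.1.1, x.1.2 - 1) := by
    funext x
    unfold stepInv
    split_ifs <;> rfl
  refine (measurableEmbedding_val hρ).measurable_comp_iff.1 ?_
  rw [show Subtype.val ∘ stepInv S ρ = fun x => (stepInv S ρ x).1 from rfl, h3]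
  have h4 : Measurable fun x : Skyscraper ρ => S.symm x.1.1 := S.symm.measurable.comp h1
  have h5 : Measurable fun x : Skyscraper ρ => x.1.2 - 1 :=
    (measurable_of_countable fun j : ℕ => j - 1).comp h2
  refine Measurable.ite (h2 (measurableSet_singleton 0)) ?_ ?_
  · exact h4.prodMk (hρ.comp h4)
  · exact h1.prodMk h5

/-- The skyscraper transformation built over `S`. -/
def step (S : Ω ≃ᵐ Ω) (hρ : Measurable ρ) : Skyscraper ρ ≃ᵐ Skyscraper ρ where
  toFun := stepFun S ρ
  invFun := stepInv S ρ
  left_inv := by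
    rintro ⟨⟨z, j⟩, hj⟩
    by_cases h : j + 1 ≤ ρ z
    · simp [stepFun, stepInv, h]
    · have : ρ z = j := by simp at hj; omega
      simp [stepFun, stepInv, this]
  right_inv := by
    rintro ⟨⟨z, j⟩, hj⟩
    rcases j with _ | j
    · simp [stepFun, stepInv]
    · simp at hj
      simp [stepFun, stepInv, hj]
  measurable_toFun := measurable_stepFun S hρ
  measurable_invFun := measurable_stepInv S hρ

lemma step_val_of_lt (S : Ω ≃ᵐ Ω) (hρ : Measurable ρ) {x : Skyscraper ρ} (h : x.1.2 < ρ x.1.1) :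
    (step S hρ x).1 = (x.1.1, x.1.2 + 1) := by
  change (stepFun S ρ x).1 = _
  simp [stepFun, Nat.succ_le_of_lt h]

lemma step_val_of_eq (S : Ω ≃ᵐ Ω) (hρ : Measurable ρ) {x : Skyscraper ρ} (h : x.1.2 = ρ x.1.1) :
    (step S hρ x).1 = (S x.1.1, 0) := by
  change (stepFun S ρ x).1 = _
  simp [stepFun, h]

lemma iterate_step_val_of_le (S : Ω ≃ᵐ Ω) (hρ : Measurable ρ) {x : Skyscraper ρ}
    (hx : x.1.2 = 0) {k : ℕ} (hk : k ≤ ρ x.1.1) :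
    ((step S hρ)^[k] x).1 = (x.1.1, k) := by
  induction k with
  | zero => exact Prod.ext rfl hx
  | succ k ih =>
    have := ih (by omega)
    rw [Function.iterate_succ_apply', step_val_of_lt] <;> rw [this]
    exact hk

/-- The (not normalized) measure on the skyscraper: `ν` on each floor. -/
def measure (ν : Measure Ω) (ρ : Ω → ℕ) : Measure (Skyscraper ρ) :=
  (ν.prod Measure.count).comap Subtype.val

variable {ν : Measure Ω} [SFinite ν]

lemma measure_apply (hρ : Measurable ρ) {A : Set (Skyscraper ρ)} (hA : MeasurableSet A) :
    measure ν ρ A = ∑' j, ν {z | ∃ h : j ≤ ρ z, (⟨(z, j), h⟩ : Skyscraper ρ) ∈ A} := by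
  have he := measurableEmbedding_val hρ
  have hm : MeasurableSet (Subtype.val '' A : Set (Ω × ℕ)) := he.measurableSet_image.2 hA
  rw [measure, he.comap_apply, Measure.prod_apply_symm hm, lintegral_count]
  congr 1
  funext j
  congr 1
  ext z
  simp

lemma measurableSet_section (hρ : Measurable ρ) {A : Set (Skyscraper ρ)} (hA : MeasurableSet A)
    (j : ℕ) : MeasurableSet {z | ∃ h : j ≤ ρ z, (⟨(z, j), h⟩ : Skyscraper ρ) ∈ A} := by
  have he := measurableEmbedding_val hρ
  have hm : MeasurableSet (Subtype.val '' A : Set (Ω × ℕ)) := he.measurableSet_image.2 hA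
  convert measurable_prodMk_right (y := j) hm using 1
  ext z
  simp

lemma measurePreserving_step {S : Ω ≃ᵐ Ω} (hS : MeasurePreserving S ν ν) (hρ : Measurable ρ) :
    MeasurePreserving (step S hρ) (measure ν ρ) (measure ν ρ) := by
  refine ⟨(step S hρ).measurable, ?_⟩
  ext A hA
  rw [Measure.map_apply (step S hρ).measurable hA,
    measure_apply hρ ((step S hρ).measurable hA), measure_apply hρ hA]
  set D : ℕ → Set Ω := fun j => {z | ∃ h : j ≤ ρ z, (⟨(z, j), h⟩ : Skyscraper ρ) ∈ A} with hD
  have hDm : ∀ j, MeasurableSet (D j) := measurableSet_section hρ hA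
  -- floor `j` of the preimage: the part below floor `j + 1`, and the top floors
  have hsplit : ∀ j, {z | ∃ h : j ≤ ρ z, (⟨(z, j), h⟩ : Skyscraper ρ) ∈ step S hρ ⁻¹' A} =
      D (j + 1) ∪ (ρ ⁻¹' {j} ∩ S ⁻¹' D 0) := by
    intro j
    ext z
    simp only [hD, Set.mem_ofPred_eq, Set.mem_union, Set.mem_inter_iff, Set.mem_preimage,
      Set.mem_singleton_iff]
    change (∃ h : j ≤ ρ z, stepFun S ρ ⟨(z, j), h⟩ ∈ A) ↔ _
    constructor
    · rintro ⟨h, hz⟩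
      by_cases hj : j + 1 ≤ ρ z
      · left
        refine ⟨hj, ?_⟩
        simpa [stepFun, hj] using hz
      · right
        refine ⟨by omega, Nat.zero_le _, ?_⟩
        simpa [stepFun, hj] using hz
    · rintro (⟨h, hz⟩ | ⟨h, _, hz⟩)
      · refine ⟨by omega, ?_⟩
        simpa [stepFun, h] using hz
      · refine ⟨h.ge, ?_⟩
        simpa [stepFun, h] using hz
  have hdisj : ∀ j, Disjoint (D (j + 1)) (ρ ⁻¹' {j} ∩ S ⁻¹' D 0) := by
    intro j
    rw [Set.disjoint_left]
    rintro z ⟨h, -⟩ ⟨h', -⟩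
    simp at h'
    omega
  have hSD : MeasurableSet (S ⁻¹' D 0) := S.measurable (hDm 0)
  simp_rw [hsplit]
  have h0 : ∑' j, ν (ρ ⁻¹' {j} ∩ S ⁻¹' D 0) = ν (D 0) := by
    rw [← hS.measure_preimage (hDm 0).nullMeasurableSet, ← measure_iUnion]
    · congr 1
      ext z
      simp
    · intro i j hij
      rw [Function.onFun, Set.disjoint_left]
      rintro z ⟨h, -⟩ ⟨h', -⟩
      simp at h h'
      omega
    · exact fun j => (hρ (measurableSet_singleton j)).inter hSD
  calc ∑' j, ν (D (j + 1) ∪ (ρ ⁻¹' {j} ∩ S ⁻¹' D 0))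
      = ∑' j, (ν (D (j + 1)) + ν (ρ ⁻¹' {j} ∩ S ⁻¹' D 0)) := by
        congr 1
        funext j
        exact measure_union (hdisj j) ((hρ (measurableSet_singleton j)).inter hSD)
    _ = ν (D 0) + ∑' j, ν (D (j + 1)) := by rw [ENNReal.tsum_add, h0, add_comm]
    _ = ∑' j, ν (D j) :=
        (tsum_eq_zero_add' (f := fun j => ν (D j)) ENNReal.summable).symm

lemma measure_univ (hρ : Measurable ρ) :
    measure ν ρ Set.univ = ∫⁻ z, (ρ z + 1 : ℕ) ∂ν := by
  rw [measure_apply hρ MeasurableSet.univ]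
  simp only [Set.mem_univ, exists_prop, and_true]
  have : ∀ z, ((ρ z + 1 : ℕ) : ENNReal) = ∑' j, Set.indicator {z | j ≤ ρ z} (fun _ => 1) z := by
    intro z
    rw [tsum_eq_sum (s := Finset.range (ρ z + 1))]
    · rw [Finset.sum_congr rfl (g := fun _ => 1)]
      · simp
      · intro j hj
        simp only [Finset.mem_range] at hj
        simp [Set.indicator, Nat.lt_succ_iff.1 hj]
    · intro j hj
      simp only [Finset.mem_range] at hj
      simp only [Set.indicator, Set.mem_ofPred_eq, ite_eq_right_iff]
      omega
  have hm : ∀ j, MeasurableSet {z | j ≤ ρ z} := fun j => measurableSet_le measurable_const hρ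
  simp_rw [this]
  rw [lintegral_tsum (fun j => (measurable_const.indicator (hm j)).aemeasurable)]
  congr 1
  funext j
  rw [lintegral_indicator (hm j)]
  simp

end Skyscraper

/-! ### The 2-adic odometer and the spacers above it -/

instance : MeasurableSpace ℤ_[2] := borel _

instance : BorelSpace ℤ_[2] := ⟨rfl⟩

namespace PadicInt

lemma two_pow_dvd_natCast_iff {E c : ℕ} : (2 : ℤ_[2]) ^ E ∣ (c : ℤ_[2]) ↔ 2 ^ E ∣ c := by
  have := pow_p_dvd_int_iff (p := 2) E (c : ℤ)
  push_cast at this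
  rw [this]
  exact_mod_cast Iff.rfl

lemma setOf_two_pow_dvd_eq_closedBall (E : ℕ) (w : ℤ_[2]) :
    {z : ℤ_[2] | (2 : ℤ_[2]) ^ E ∣ z - w} = Metric.closedBall w ((2 : ℝ) ^ (-E : ℤ)) := by
  ext z
  rw [Metric.mem_closedBall, dist_eq_norm]
  have := norm_le_pow_iff_mem_span_pow (p := 2) (z - w) E
  rw [Ideal.mem_span_singleton] at this
  push_cast at this
  rw [this]
  rfl

lemma measurableSet_two_pow_dvd (E : ℕ) (w : ℤ_[2]) :
    MeasurableSet {z : ℤ_[2] | (2 : ℤ_[2]) ^ E ∣ z - w} := by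
  rw [setOf_two_pow_dvd_eq_closedBall]
  exact Metric.isClosed_closedBall.measurableSet

lemma exists_lt_two_pow_dvd_sub (z : ℤ_[2]) (E : ℕ) :
    ∃ c < 2 ^ E, (2 : ℤ_[2]) ^ E ∣ z - (c : ℕ) := by
  refine ⟨z.appr E, z.appr_lt E, ?_⟩
  have := appr_spec (p := 2) E z
  rw [Ideal.mem_span_singleton] at this
  exact_mod_cast this

lemma eq_of_forall_two_pow_dvd {z w : ℤ_[2]} {e : ℕ → ℕ} (he : ∀ n, n ≤ e n)
    (h : ∃ n₀, ∀ n ≥ n₀, (2 : ℤ_[2]) ^ e n ∣ z - w) : z = w := by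
  obtain ⟨n₀, h⟩ := h
  rw [← sub_eq_zero, ← norm_le_zero_iff]
  have h1 : Tendsto (fun n : ℕ => (2 : ℝ)⁻¹ ^ n) atTop (nhds 0) :=
    tendsto_pow_atTop_nhds_zero_of_lt_one (by norm_num) (by norm_num)
  refine ge_of_tendsto h1 ?_
  filter_upwards [eventually_ge_atTop n₀] with n hn
  have h2 : (2 : ℤ_[2]) ^ n ∣ z - w := (pow_dvd_pow _ (he n)).trans (h n hn)
  have h3 := (norm_le_pow_iff_mem_span_pow (p := 2) (z - w) n).2
    (Ideal.mem_span_singleton.2 (by exact_mod_cast h2))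
  simpa using h3

open scoped ENNReal in
/-- A coset of `2 ^ E ℤ₂` carries at most the fraction `2 ^ (-E)` of a translation-invariant
measure, since its `2 ^ E` translates are disjoint. -/
lemma measure_two_pow_dvd_le (ν : Measure ℤ_[2]) [ν.IsAddLeftInvariant] (E : ℕ) (w : ℤ_[2]) :
    ν {z | (2 : ℤ_[2]) ^ E ∣ z - w} ≤ ν Set.univ / 2 ^ E := by
  rw [ENNReal.le_div_iff_mul_le (by simp) (by simp)]
  have h1 : ∀ c : ℕ, ν {z | (2 : ℤ_[2]) ^ E ∣ z - (c + w)} = ν {z | (2 : ℤ_[2]) ^ E ∣ z - w} := by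
    intro c
    rw [← measure_preimage_add ν (c : ℤ_[2])]
    congr 1
    ext z
    simp
  have h2 : ν (⋃ c ∈ Finset.range (2 ^ E), {z | (2 : ℤ_[2]) ^ E ∣ z - ((c : ℕ) + w)}) =
      ∑ c ∈ Finset.range (2 ^ E), ν {z | (2 : ℤ_[2]) ^ E ∣ z - ((c : ℕ) + w)} := by
    refine measure_biUnion_finset ?_ fun c _ => measurableSet_two_pow_dvd E _
    intro c hc d hd hcd
    wlog hlt : d < c generalizing c d
    · exact (this hd hc hcd.symm (by omega)).symm
    rw [Function.onFun, Set.disjoint_left]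
    intro z hz hz'
    simp only [Set.mem_ofPred_eq] at hz hz'
    have h3 : (2 : ℤ_[2]) ^ E ∣ ((c - d : ℕ) : ℤ_[2]) := by
      rw [Nat.cast_sub hlt.le]
      convert dvd_sub hz' hz using 1
      ring
    have := Nat.le_of_dvd (by omega) (two_pow_dvd_natCast_iff.1 h3)
    simp at hc
    omega
  simp_rw [h1] at h2
  rw [Finset.sum_const, Finset.card_range, nsmul_eq_mul, mul_comm] at h2
  push_cast at h2
  rw [← h2]
  exact measure_mono (Set.subset_univ _)

end PadicInt

namespace Odometer

/-- The `n`-th tower has `2 ^ expo b n` levels in the base of the first tower, when the `i`-th tower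
is cut into `2 ^ b i` columns. -/
def expo (b : ℕ → ℕ) (n : ℕ) : ℕ := ∑ i ∈ Finset.range n, b i

lemma expo_succ (b : ℕ → ℕ) (n : ℕ) : expo b (n + 1) = expo b n + b n :=
  Finset.sum_range_succ _ _

lemma expo_mono (b : ℕ → ℕ) : Monotone (expo b) :=
  monotone_nat_of_le_succ fun n => by rw [expo_succ]; omega

lemma le_expo {b : ℕ → ℕ} (hb : ∀ n, 1 ≤ b n) (n : ℕ) : n ≤ expo b n := by
  induction n with
  | zero => simp
  | succ n ih => rw [expo_succ]; have := hb n; omega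

/-- The 2-adic integer `z` is the last base level of the column `p.2` of the tower `p.1`, and that
column is not the last one: the successor `z + 1` starts the column `p.2 + 1`. -/
def IsColumnEnd (b : ℕ → ℕ) (p : ℕ × ℕ) (z : ℤ_[2]) : Prop :=
  p.2 + 1 < 2 ^ b p.1 ∧
    (2 : ℤ_[2]) ^ expo b (p.1 + 1) ∣ z + 1 - ((p.2 + 1 : ℕ) : ℤ_[2]) * 2 ^ expo b p.1

lemma IsColumnEnd.unique {b : ℕ → ℕ} {p p' : ℕ × ℕ} {z : ℤ_[2]} (h : IsColumnEnd b p z)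
    (h' : IsColumnEnd b p' z) : p = p' := by
  wlog hle : p.1 ≤ p'.1 generalizing p p'
  · exact (this h' h (by omega)).symm
  obtain ⟨n, i⟩ := p
  obtain ⟨n', i'⟩ := p'
  obtain ⟨hi, hz⟩ := h
  obtain ⟨hi', hz'⟩ := h'
  simp only at hi hz hi' hz' hle
  rcases hle.eq_or_lt with rfl | hlt
  · have key : ∀ i i', i < i' → i' + 1 < 2 ^ b n →
        (2 : ℤ_[2]) ^ expo b (n + 1) ∣ z + 1 - ((i + 1 : ℕ) : ℤ_[2]) * 2 ^ expo b n →
        ¬ (2 : ℤ_[2]) ^ expo b (n + 1) ∣ z + 1 - ((i' + 1 : ℕ) : ℤ_[2]) * 2 ^ expo b n := by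
      intro i i' hlt hi' hz hz'
      have h1 : (2 : ℤ_[2]) ^ expo b (n + 1) ∣ (((i' - i) * 2 ^ expo b n : ℕ) : ℤ_[2]) := by
        convert dvd_sub hz hz' using 1
        push_cast [Nat.cast_sub hlt.le]
        ring
      rw [PadicInt.two_pow_dvd_natCast_iff, expo_succ, pow_add, mul_comm,
        Nat.mul_dvd_mul_iff_right (by positivity)] at h1
      have := Nat.le_of_dvd (by omega) h1
      omega
    rcases lt_trichotomy i i' with hlt | rfl | hlt
    · exact absurd hz' (key i i' hlt hi' hz)
    · rfl
    · exact absurd hz (key i' i hlt hi hz')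
  · exfalso
    have h1 : (2 : ℤ_[2]) ^ expo b (n + 1) ∣ z + 1 := by
      have h2 : (2 : ℤ_[2]) ^ expo b (n + 1) ∣ 2 ^ expo b n' := pow_dvd_pow _ (expo_mono b hlt)
      have h3 : (2 : ℤ_[2]) ^ expo b (n + 1) ∣ 2 ^ expo b (n' + 1) :=
        pow_dvd_pow _ (expo_mono b (by omega))
      have := dvd_add (h3.trans hz') (h2.mul_left ((i' + 1 : ℕ) : ℤ_[2]))
      simpa using this
    have h2 : (2 : ℤ_[2]) ^ expo b (n + 1) ∣ (((i + 1) * 2 ^ expo b n : ℕ) : ℤ_[2]) := by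
      convert dvd_sub h1 hz using 1
      push_cast
      ring
    rw [PadicInt.two_pow_dvd_natCast_iff, expo_succ, pow_add, mul_comm,
      Nat.mul_dvd_mul_iff_right (by positivity)] at h2
    have := Nat.le_of_dvd (by omega) h2
    omega

lemma measurableSet_isColumnEnd (b : ℕ → ℕ) (p : ℕ × ℕ) :
    MeasurableSet {z | IsColumnEnd b p z} := by
  by_cases hp : p.2 + 1 < 2 ^ b p.1
  · convert PadicInt.measurableSet_two_pow_dvd (expo b (p.1 + 1))
      (((p.2 + 1 : ℕ) : ℤ_[2]) * 2 ^ expo b p.1 - 1) using 1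
    ext z
    simp only [IsColumnEnd, hp, true_and, Set.mem_ofPred_eq]
    rw [show z + 1 - ((p.2 + 1 : ℕ) : ℤ_[2]) * 2 ^ expo b p.1 =
      z - (((p.2 + 1 : ℕ) : ℤ_[2]) * 2 ^ expo b p.1 - 1) by ring]
  · simp [IsColumnEnd, hp]

open Classical in
/-- The number of spacers above the base level `z`. The point `z = -1`, which ends a column in no
tower, gets none. -/
def spacersAbove (b : ℕ → ℕ) (a : ℕ → ℕ → ℕ) (z : ℤ_[2]) : ℕ :=
  if h : ∃ p, IsColumnEnd b p z then a h.choose.1 h.choose.2 else 0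

lemma IsColumnEnd.spacersAbove_eq {b : ℕ → ℕ} {p : ℕ × ℕ} {z : ℤ_[2]} (h : IsColumnEnd b p z)
    (a : ℕ → ℕ → ℕ) : spacersAbove b a z = a p.1 p.2 := by
  have hex : ∃ p, IsColumnEnd b p z := ⟨p, h⟩
  rw [spacersAbove, dif_pos hex, hex.choose_spec.unique h]

lemma exists_isColumnEnd_of_pos {b : ℕ → ℕ} {a : ℕ → ℕ → ℕ} {z : ℤ_[2]}
    (h : 0 < spacersAbove b a z) : ∃ p, IsColumnEnd b p z := by
  by_contra hex
  rw [spacersAbove, dif_neg hex] at h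
  omega

lemma measurable_spacersAbove (b : ℕ → ℕ) (a : ℕ → ℕ → ℕ) : Measurable (spacersAbove b a) := by
  refine measurable_to_countable' fun c => ?_
  have h0 : MeasurableSet (⋃ p, {z | IsColumnEnd b p z}) :=
    MeasurableSet.iUnion fun p => measurableSet_isColumnEnd b p
  have h1 : MeasurableSet (⋃ (p : ℕ × ℕ) (_ : a p.1 p.2 = c), {z | IsColumnEnd b p z}) :=
    MeasurableSet.iUnion fun p => MeasurableSet.iUnion fun _ => measurableSet_isColumnEnd b p
  have h2 : spacersAbove b a ⁻¹' {c} = (⋃ (p : ℕ × ℕ) (_ : a p.1 p.2 = c),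
      {z | IsColumnEnd b p z}) ∪ ((⋃ p, {z | IsColumnEnd b p z})ᶜ ∩ {_z | c = 0}) := by
    ext z
    simp only [Set.mem_preimage, Set.mem_singleton_iff, Set.mem_union, Set.mem_iUnion,
      Set.mem_ofPred_eq, exists_prop, Set.mem_inter_iff, Set.mem_compl_iff]
    by_cases hex : ∃ p, IsColumnEnd b p z
    · obtain ⟨p, hp⟩ := hex
      rw [hp.spacersAbove_eq]
      constructor
      · exact fun h => Or.inl ⟨p, h, hp⟩
      · rintro (⟨p', h, hp'⟩ | ⟨h, -⟩)
        · rw [hp.unique hp', h]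
        · exact absurd ⟨p, hp⟩ h
    · rw [spacersAbove, dif_neg hex]
      constructor
      · exact fun h => Or.inr ⟨hex, h.symm⟩
      · rintro (⟨p', -, hp'⟩ | ⟨-, h⟩)
        · exact absurd ⟨p', hp'⟩ hex
        · exact h.symm
  rw [h2]
  exact h1.union (h0.compl.inter (MeasurableSet.const _))

open scoped ENNReal in
lemma lintegral_spacersAbove_ne_top (ν : Measure ℤ_[2]) [ν.IsAddLeftInvariant] [IsFiniteMeasure ν]
    {b : ℕ → ℕ} {a : ℕ → ℕ → ℕ}
    (ha : ∑' n, (spacerTotal (2 ^ b n) (a n) : ℝ≥0∞) / 2 ^ expo b (n + 1) ≠ ∞) :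
    ∫⁻ z, (spacersAbove b a z : ℝ≥0∞) ∂ν ≠ ∞ := by
  have h1 : ∀ z, (spacersAbove b a z : ℝ≥0∞) ≤ ∑' n, ∑ i ∈ Finset.range (2 ^ b n - 1),
      {z | IsColumnEnd b (n, i) z}.indicator (fun _ => (a n i : ℝ≥0∞)) z := by
    intro z
    rcases (spacersAbove b a z).eq_zero_or_pos with h | h
    · simp [h]
    · obtain ⟨⟨n, i⟩, hp⟩ := exists_isColumnEnd_of_pos h
      have hi : i ∈ Finset.range (2 ^ b n - 1) := by
        have := hp.1
        simp only at this
        rw [Finset.mem_range]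
        omega
      refine le_trans ?_ (ENNReal.le_tsum n)
      refine le_trans ?_ (Finset.single_le_sum (fun _ _ => zero_le) hi)
      rw [Set.indicator_of_mem (by exact hp), hp.spacersAbove_eq]
  have h2 : ∀ n i, Measurable
      ({z | IsColumnEnd b (n, i) z}.indicator (fun _ => (a n i : ℝ≥0∞))) :=
    fun n i => measurable_const.indicator (measurableSet_isColumnEnd b _)
  have h3 : ∀ n i, ν {z | IsColumnEnd b (n, i) z} ≤ ν Set.univ / 2 ^ expo b (n + 1) := by
    intro n i
    refine le_trans (measure_mono ?_) (PadicInt.measure_two_pow_dvd_le ν (expo b (n + 1))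
      (((i + 1 : ℕ) : ℤ_[2]) * 2 ^ expo b n - 1))
    rintro z ⟨-, hz⟩
    simp only [Set.mem_ofPred_eq]
    convert hz using 1
    ring
  refine ne_top_of_le_ne_top ?_ (lintegral_mono h1)
  rw [lintegral_tsum fun n => (Finset.measurable_sum _ fun i _ => h2 n i).aemeasurable]
  refine ne_top_of_le_ne_top (ENNReal.mul_ne_top ha (measure_ne_top ν Set.univ)) ?_
  rw [← ENNReal.tsum_mul_right]
  refine ENNReal.tsum_le_tsum fun n => ?_
  rw [lintegral_finsetSum _ fun i _ => h2 n i]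
  simp_rw [lintegral_indicator (measurableSet_isColumnEnd b _), setLIntegral_const]
  calc ∑ i ∈ Finset.range (2 ^ b n - 1), (a n i : ℝ≥0∞) * ν {z | IsColumnEnd b (n, i) z}
      ≤ ∑ i ∈ Finset.range (2 ^ b n - 1), (a n i : ℝ≥0∞) * (ν Set.univ / 2 ^ expo b (n + 1)) := by
        gcongr
        exact h3 _ _
    _ = _ := by
        rw [← Finset.sum_mul, spacerTotal]
        push_cast
        rw [ENNReal.div_eq_inv_mul, ENNReal.div_eq_inv_mul]
        ring

end Odometer

/-! ### The towers over the odometer -/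

lemma towerHeight_pos {q : ℕ → ℕ} {a : ℕ → ℕ → ℕ} (hq : ∀ n, 1 ≤ q n) (n : ℕ) :
    0 < towerHeight q a n := by
  induction n with
  | zero => exact Nat.one_pos
  | succ n ih =>
    rw [towerHeight]
    have := Nat.mul_pos (hq n) ih
    omega

/-- The level of the tower of index `n + 1` at which the `i`-th column of the tower of index `n`
starts. -/
def columnStart (q : ℕ → ℕ) (a : ℕ → ℕ → ℕ) (n i : ℕ) : ℕ :=
  i * towerHeight q a n + ∑ j ∈ Finset.range i, a n j

lemma columnStart_zero (q : ℕ → ℕ) (a : ℕ → ℕ → ℕ) (n : ℕ) : columnStart q a n 0 = 0 := by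
  simp [columnStart]

lemma columnStart_succ (q : ℕ → ℕ) (a : ℕ → ℕ → ℕ) (n i : ℕ) :
    columnStart q a n (i + 1) = columnStart q a n i + (towerHeight q a n + a n i) := by
  rw [columnStart, columnStart, Finset.sum_range_succ]
  ring

lemma towerHeight_succ_eq_columnStart {q : ℕ → ℕ} (a : ℕ → ℕ → ℕ) (hq : ∀ n, 1 ≤ q n) (n : ℕ) :
    towerHeight q a (n + 1) = columnStart q a n (q n - 1) + towerHeight q a n := by
  rw [towerHeight, columnStart, spacerTotal]
  obtain ⟨k, hk⟩ := Nat.exists_eq_add_of_le (hq n)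
  rw [hk, Nat.add_sub_cancel_left]
  ring

/-- An induction principle for the levels of the tower of index `n + 1`: each is a level of one of
the columns of the tower of index `n`, or a spacer above one of these columns. -/
lemma towerHeight_succ_induction {q : ℕ → ℕ} {a : ℕ → ℕ → ℕ} (hq : ∀ n, 1 ≤ q n) {n : ℕ}
    {P : ℕ → Prop}
    (hcol : ∀ i k, i < q n → k < towerHeight q a n → P (columnStart q a n i + k))
    (hsp : ∀ i j, i + 1 < q n → j < a n i →
      P (columnStart q a n i + (towerHeight q a n + j))) {k : ℕ}
    (hk : k < towerHeight q a (n + 1)) : P k := by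
  have key : ∀ i < q n, ∀ k < columnStart q a n i + towerHeight q a n, P k := by
    intro i
    induction i with
    | zero =>
      intro hi k hk
      have := hcol 0 k hi
      rw [columnStart_zero, zero_add] at this hk
      exact this hk
    | succ i ih =>
      intro hi k hk
      rw [columnStart_succ] at hk
      by_cases h1 : k < columnStart q a n i + towerHeight q a n
      · exact ih (by omega) k h1
      by_cases h2 : k < columnStart q a n i + (towerHeight q a n + a n i)
      · have := hsp i (k - (columnStart q a n i + towerHeight q a n)) hi (by omega)
        convert this using 1
        omega
      · have := hcol (i + 1) (k - columnStart q a n (i + 1)) hi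
          (by rw [columnStart_succ]; omega)
        rw [columnStart_succ] at this
        convert this using 1
        omega
  have := hq n
  exact key (q n - 1) (by omega) k (by rwa [towerHeight_succ_eq_columnStart a hq] at hk)

namespace Odometer

/-- The skyscraper transformation over the 2-adic odometer `z ↦ z + 1` with spacers `a n i`. -/
abbrev transformation (b : ℕ → ℕ) (a : ℕ → ℕ → ℕ) :
    Skyscraper (spacersAbove b a) ≃ᵐ Skyscraper (spacersAbove b a) :=
  Skyscraper.step (MeasurableEquiv.addRight (1 : ℤ_[2])) (measurable_spacersAbove b a)

/-- The base of the `n`-th tower: the subgroup `2 ^ expo b n ℤ₂` on floor `0`. -/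
def base (b : ℕ → ℕ) (a : ℕ → ℕ → ℕ) (n : ℕ) : Set (Skyscraper (spacersAbove b a)) :=
  {x | x.1.2 = 0 ∧ (2 : ℤ_[2]) ^ expo b n ∣ x.1.1}

/-- The `i`-th cut of the base of the `n`-th tower: a coset of `2 ^ expo b (n + 1) ℤ₂`. -/
def cut (b : ℕ → ℕ) (a : ℕ → ℕ → ℕ) (n i : ℕ) : Set (Skyscraper (spacersAbove b a)) :=
  {x | x.1.2 = 0 ∧ (2 : ℤ_[2]) ^ expo b (n + 1) ∣ x.1.1 - (i : ℤ_[2]) * 2 ^ expo b n}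

/-- The `j`-th spacer level above the `i`-th column of the `n`-th tower: floor `j + 1` over the
points whose successor starts the next column. -/
def spacer (b : ℕ → ℕ) (a : ℕ → ℕ → ℕ) (n i j : ℕ) : Set (Skyscraper (spacersAbove b a)) :=
  {x | x.1.2 = j + 1 ∧
    (2 : ℤ_[2]) ^ expo b (n + 1) ∣ x.1.1 + 1 - ((i + 1 : ℕ) : ℤ_[2]) * 2 ^ expo b n}

/-- All points of the base climb in parallel, reach the last base level of the tower at its top, and
do not return to the base before. -/
structure TowerClimb (b : ℕ → ℕ) (a : ℕ → ℕ → ℕ) (n : ℕ) : Prop where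
  parallel : ∀ k < towerHeight (fun n => 2 ^ b n) a n, ∃ (u : ℤ_[2]) (v : ℕ),
    (0 < k → v = 0 → ¬ (2 : ℤ_[2]) ^ expo b n ∣ u) ∧
    ∀ x ∈ base b a n, ((transformation b a)^[k] x).1 = (x.1.1 + u, v)
  top : ∀ x ∈ base b a n,
    ((transformation b a)^[towerHeight (fun n => 2 ^ b n) a n - 1] x).1 =
      (x.1.1 + (2 ^ expo b n - 1), 0)

variable {b : ℕ → ℕ} {a : ℕ → ℕ → ℕ}

local notation "hgt" => towerHeight (fun n => 2 ^ b n) a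
local notation "start" => columnStart (fun n => 2 ^ b n) a

lemma one_le_two_pow (b : ℕ → ℕ) (n : ℕ) : 1 ≤ (fun n => 2 ^ b n) n := Nat.one_le_two_pow

lemma two_pow_expo_dvd_succ (b : ℕ → ℕ) (n : ℕ) :
    (2 : ℤ_[2]) ^ expo b n ∣ 2 ^ expo b (n + 1) :=
  pow_dvd_pow _ (expo_mono b n.le_succ)

lemma cut_subset_base (n i : ℕ) : cut b a n i ⊆ base b a n := by
  rintro x ⟨h0, hx⟩
  refine ⟨h0, ?_⟩
  have := dvd_add ((two_pow_expo_dvd_succ b n).trans hx) (dvd_mul_left ((2 : ℤ_[2]) ^ expo b n) i)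
  simpa using this

lemma isColumnEnd_of_mem_cut {n i : ℕ} (hi : i + 1 < 2 ^ b n)
    {x : Skyscraper (spacersAbove b a)} (hx : x ∈ cut b a n i) :
    IsColumnEnd b (n, i) (x.1.1 + (2 ^ expo b n - 1)) := by
  refine ⟨hi, ?_⟩
  convert hx.2 using 1
  push_cast
  ring

namespace TowerClimb

variable {n : ℕ}

lemma iterate_floor (H : TowerClimb b a n) {i j : ℕ} (hi : i + 1 < 2 ^ b n) (hj : j ≤ a n i)
    {x : Skyscraper (spacersAbove b a)} (hx : x ∈ cut b a n i) :
    ((transformation b a)^[hgt n - 1 + j] x).1 = (x.1.1 + (2 ^ expo b n - 1), j) := by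
  have h1 := H.top x (cut_subset_base n i hx)
  rw [add_comm, Function.iterate_add_apply, Skyscraper.iterate_step_val_of_le]
  · rw [h1]
  · rw [h1]
  · rw [h1]
    simpa [(isColumnEnd_of_mem_cut hi hx).spacersAbove_eq a] using hj

lemma iterate_next (H : TowerClimb b a n) {i : ℕ} (hi : i + 1 < 2 ^ b n)
    {x : Skyscraper (spacersAbove b a)} (hx : x ∈ cut b a n i) :
    ((transformation b a)^[hgt n + a n i] x).1 = (x.1.1 + 2 ^ expo b n, 0) := by
  have h1 := H.iterate_floor hi le_rfl hx
  have hpos := towerHeight_pos (a := a) (one_le_two_pow b) n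
  rw [show hgt n + a n i = (hgt n - 1 + a n i) + 1 by omega, Function.iterate_succ_apply',
    Skyscraper.step_val_of_eq]
  · rw [h1]
    simp only [MeasurableEquiv.coe_addRight]
    exact Prod.ext (by ring) rfl
  · rw [h1]
    simp [(isColumnEnd_of_mem_cut hi hx).spacersAbove_eq a]

lemma iterate_start (H : TowerClimb b a n) {x : Skyscraper (spacersAbove b a)}
    (hx : x ∈ base b a (n + 1)) {i : ℕ} (hi : i < 2 ^ b n) :
    ((transformation b a)^[start n i] x).1 = (x.1.1 + i * 2 ^ expo b n, 0) := by
  induction i with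
  | zero =>
    rw [columnStart_zero]
    exact Prod.ext (by simp) hx.1
  | succ i ih =>
    have h1 := ih (by omega)
    rw [columnStart_succ, add_comm, Function.iterate_add_apply, H.iterate_next hi]
    · rw [h1]
      refine Prod.ext ?_ rfl
      push_cast
      ring
    · refine ⟨by rw [h1], ?_⟩
      rw [h1]
      simpa using hx.2

lemma iterate_start_mem (H : TowerClimb b a n) {x : Skyscraper (spacersAbove b a)}
    (hx : x ∈ base b a (n + 1)) {i : ℕ} (hi : i < 2 ^ b n) :
    (transformation b a)^[start n i] x ∈ cut b a n i := by
  refine ⟨by rw [H.iterate_start hx hi], ?_⟩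
  rw [H.iterate_start hx hi]
  simpa using hx.2

end TowerClimb

lemma towerClimb (n : ℕ) : TowerClimb b a n := by
  induction n with
  | zero =>
    refine ⟨fun k hk => ⟨0, 0, fun h => ?_, fun x hx => ?_⟩, fun x hx => ?_⟩
    · simp [towerHeight] at hk
      omega
    · simp only [towerHeight, Nat.lt_one_iff] at hk
      subst hk
      exact Prod.ext (by simp) hx.1
    · exact Prod.ext (by simp [towerHeight, expo]) hx.1
  | succ n H =>
    constructor
    · intro k hk
      refine towerHeight_succ_induction (P := fun k => ∃ (u : ℤ_[2]) (v : ℕ),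
        (0 < k → v = 0 → ¬ (2 : ℤ_[2]) ^ expo b (n + 1) ∣ u) ∧ ∀ x ∈ base b a (n + 1),
          ((transformation b a)^[k] x).1 = (x.1.1 + u, v)) (one_le_two_pow b) ?_ ?_ hk
      · intro i k hi hk
        have hmem := fun x hx => cut_subset_base n i (H.iterate_start_mem (x := x) hx hi)
        rcases k.eq_zero_or_pos with rfl | hpos
        · refine ⟨i * 2 ^ expo b n, 0, fun h _ hdvd => ?_, fun x hx => H.iterate_start hx hi⟩
          have h1 : (2 : ℤ_[2]) ^ expo b (n + 1) ∣ ((i * 2 ^ expo b n : ℕ) : ℤ_[2]) := by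
            exact_mod_cast hdvd
          rw [PadicInt.two_pow_dvd_natCast_iff, expo_succ, pow_add, mul_comm,
            Nat.mul_dvd_mul_iff_right (by positivity)] at h1
          rcases i.eq_zero_or_pos with rfl | h0
          · simp [columnStart_zero] at h
          · exact absurd (Nat.le_of_dvd h0 h1) (by simpa using hi)
        · obtain ⟨u, v, h1, h2⟩ := H.parallel k hk
          refine ⟨i * 2 ^ expo b n + u, v, fun _ hv hdvd => h1 hpos hv ?_, fun x hx => ?_⟩
          · exact (dvd_add_right (dvd_mul_left _ _)).1 ((two_pow_expo_dvd_succ b n).trans hdvd)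
          · rw [add_comm, Function.iterate_add_apply, h2 _ (hmem x hx), H.iterate_start hx hi,
              add_assoc]
      · intro i j hi hj
        refine ⟨i * 2 ^ expo b n + (2 ^ expo b n - 1), j + 1, fun _ h => absurd h (by omega),
          fun x hx => ?_⟩
        have hpos := towerHeight_pos (a := a) (one_le_two_pow b) n
        rw [show start n i + (hgt n + j) = (hgt n - 1 + (j + 1)) + start n i by omega,
          Function.iterate_add_apply, H.iterate_floor hi hj (H.iterate_start_mem hx (by omega)),
          H.iterate_start hx (by omega), add_assoc]
    · intro x hx
      have hi : 2 ^ b n - 1 < 2 ^ b n := by have := one_le_two_pow b n; simp at this; omega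
      have hpos := towerHeight_pos (a := a) (one_le_two_pow b) n
      rw [towerHeight_succ_eq_columnStart a (one_le_two_pow b),
        show start n (2 ^ b n - 1) + hgt n - 1 = (hgt n - 1) + start n (2 ^ b n - 1) by omega,
        Function.iterate_add_apply, H.top _ (cut_subset_base n _ (H.iterate_start_mem hx hi)),
        H.iterate_start hx hi]
      refine Prod.ext ?_ rfl
      rw [expo_succ, pow_add, Nat.cast_sub Nat.one_le_two_pow]
      push_cast
      ring

end Odometer

/-! ### Rank one systems with given spacers -/

/-- In a standard Borel space, countably many measurable sets that separate points generate the
`σ`-algebra. -/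
lemma generateFrom_eq_of_countable_of_separating {X : Type*} [m : MeasurableSpace X]
    [StandardBorelSpace X] {S : Set (Set X)} (hc : S.Countable) (hS : ∀ s ∈ S, MeasurableSet s)
    (hsep : ∀ x y, (∀ s ∈ S, x ∈ s ↔ y ∈ s) → x = y) :
    MeasurableSpace.generateFrom S = m := by
  have hle : MeasurableSpace.generateFrom S ≤ m := MeasurableSpace.generateFrom_le hS
  have hcs : @MeasurableSpace.CountablySeparated X (MeasurableSpace.generateFrom S) :=
    @MeasurableSpace.CountablySeparated.mk X (MeasurableSpace.generateFrom S)
      ⟨S, hc, fun s hs => MeasurableSpace.measurableSet_generateFrom hs,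
        fun x _ y _ h => hsep x y h⟩
  have := @Measurable.map_measurableSpace_eq X X m _ (MeasurableSpace.generateFrom S) hcs id
    (fun s hs => hle s hs) Function.surjective_id
  rw [MeasurableSpace.map_id] at this
  exact this.symm

namespace Odometer

variable {b : ℕ → ℕ} {a : ℕ → ℕ → ℕ}

local notation "hgt" => towerHeight (fun n => 2 ^ b n) a
local notation "start" => columnStart (fun n => 2 ^ b n) a

lemma mem_cut_zero_iff {n : ℕ} {x : Skyscraper (spacersAbove b a)} :
    x ∈ cut b a n 0 ↔ x ∈ base b a (n + 1) := by
  simp [cut, base]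

lemma exists_mem_cut {n : ℕ} {x : Skyscraper (spacersAbove b a)} (hx : x ∈ base b a n) :
    ∃ i < 2 ^ b n, x ∈ cut b a n i := by
  obtain ⟨h0, w, hw⟩ := hx
  obtain ⟨i, hi, hd⟩ := PadicInt.exists_lt_two_pow_dvd_sub w (b n)
  refine ⟨i, hi, h0, ?_⟩
  rw [hw, expo_succ, pow_add]
  convert mul_dvd_mul_left ((2 : ℤ_[2]) ^ expo b n) hd using 1
  ring

lemma eq_of_mem_cut {n i i' : ℕ} {x : Skyscraper (spacersAbove b a)} (hi : i < 2 ^ b n)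
    (hi' : i' < 2 ^ b n) (hx : x ∈ cut b a n i) (hx' : x ∈ cut b a n i') : i = i' := by
  wlog hlt : i < i' generalizing i i'
  · by_contra hne
    exact hne (this hi' hi hx' hx (by omega)).symm
  exfalso
  have h1 : (2 : ℤ_[2]) ^ expo b (n + 1) ∣ (((i' - i) * 2 ^ expo b n : ℕ) : ℤ_[2]) := by
    convert dvd_sub hx.2 hx'.2 using 1
    push_cast [Nat.cast_sub hlt.le]
    ring
  rw [PadicInt.two_pow_dvd_natCast_iff, expo_succ, pow_add, mul_comm,
    Nat.mul_dvd_mul_iff_right (by positivity)] at h1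
  have := Nat.le_of_dvd (by omega) h1
  omega

/-- Every point of the `i`-th cut is reached from the base of the next tower. -/
lemma exists_iterate_start_eq {n i : ℕ} (hi : i < 2 ^ b n) {x : Skyscraper (spacersAbove b a)}
    (hx : x ∈ cut b a n i) :
    ∃ y ∈ base b a (n + 1), (transformation b a)^[start n i] y = x := by
  let y : Skyscraper (spacersAbove b a) := ⟨(x.1.1 - i * 2 ^ expo b n, 0), Nat.zero_le _⟩
  have hy : y ∈ base b a (n + 1) := ⟨rfl, hx.2⟩
  refine ⟨y, hy, Subtype.ext ?_⟩
  rw [(towerClimb n).iterate_start hy hi]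
  exact Prod.ext (by simp [y]) hx.1.symm

/-- The union of the levels of the `n`-th tower. -/
def towerSet (b : ℕ → ℕ) (a : ℕ → ℕ → ℕ) (n : ℕ) : Set (Skyscraper (spacersAbove b a)) :=
  {x | ∃ k < towerHeight (fun n => 2 ^ b n) a n, x ∈ (transformation b a)^[k] '' base b a n}

lemma start_add_lt {n i k : ℕ} (hi : i < 2 ^ b n) (hk : k < hgt n) :
    start n i + k < hgt (n + 1) := by
  rw [towerHeight_succ_eq_columnStart a (one_le_two_pow b)]
  have : start n i ≤ start n (2 ^ b n - 1) :=
    monotone_nat_of_le_succ (fun i => by rw [columnStart_succ]; omega) (by omega)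
  omega

lemma start_add_spacer_lt {n i j : ℕ} (hi : i + 1 < 2 ^ b n) (hj : j < a n i) :
    start n i + (hgt n + j) < hgt (n + 1) := by
  have := start_add_lt hi (towerHeight_pos (a := a) (one_le_two_pow b) n)
  rw [columnStart_succ] at this
  omega

lemma towerSet_mono : Monotone (towerSet b a) := by
  refine monotone_nat_of_le_succ fun n => ?_
  rintro _ ⟨k, hk, x, hx, rfl⟩
  obtain ⟨i, hi, hxi⟩ := exists_mem_cut hx
  obtain ⟨y, hy, rfl⟩ := exists_iterate_start_eq hi hxi
  refine ⟨start n i + k, start_add_lt hi hk, y, hy, ?_⟩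
  rw [add_comm, Function.iterate_add_apply]

lemma exists_mem_towerSet (x : Skyscraper (spacersAbove b a)) : ∃ n, x ∈ towerSet b a n := by
  obtain ⟨⟨z, j⟩, hj⟩ := x
  rcases j with _ | j
  · exact ⟨0, 0, by simp [towerHeight], _, ⟨rfl, by simp [expo]⟩, rfl⟩
  · simp only at hj
    obtain ⟨⟨n, i⟩, hp⟩ := exists_isColumnEnd_of_pos (Nat.zero_lt_of_lt hj)
    have hja : j + 1 ≤ a n i := by rwa [hp.spacersAbove_eq] at hj
    obtain ⟨hi, hd⟩ := hp
    simp only at hi hd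
    let x : Skyscraper (spacersAbove b a) := ⟨(z + 1 - 2 ^ expo b n, 0), Nat.zero_le _⟩
    have hx : x ∈ cut b a n i := by
      refine ⟨rfl, ?_⟩
      convert hd using 1
      simp only [x]
      push_cast
      ring
    obtain ⟨y, hy, hyx⟩ := exists_iterate_start_eq (by omega) hx
    refine ⟨n + 1, start n i + (hgt n + j), start_add_spacer_lt hi hja, y, hy, Subtype.ext ?_⟩
    have hpos := towerHeight_pos (a := a) (one_le_two_pow b) n
    rw [show start n i + (hgt n + j) = (hgt n - 1 + (j + 1)) + start n i by omega,
      Function.iterate_add_apply, hyx, (towerClimb n).iterate_floor hi hja hx]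
    exact Prod.ext (by simp [x]) rfl

lemma measurableSet_base (n : ℕ) : MeasurableSet (base b a n) := by
  have h1 : Measurable fun x : Skyscraper (spacersAbove b a) => x.1.1 :=
    measurable_fst.comp measurable_subtype_coe
  have h2 : Measurable fun x : Skyscraper (spacersAbove b a) => x.1.2 :=
    measurable_snd.comp measurable_subtype_coe
  convert (h2 (measurableSet_singleton 0)).inter
    (h1 (PadicInt.measurableSet_two_pow_dvd (expo b n) 0)) using 1
  ext x
  simp [base]

lemma measurableSet_cut (n i : ℕ) : MeasurableSet (cut b a n i) := by
  have h1 : Measurable fun x : Skyscraper (spacersAbove b a) => x.1.1 :=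
    measurable_fst.comp measurable_subtype_coe
  have h2 : Measurable fun x : Skyscraper (spacersAbove b a) => x.1.2 :=
    measurable_snd.comp measurable_subtype_coe
  exact (h2 (measurableSet_singleton 0)).inter
    (h1 (PadicInt.measurableSet_two_pow_dvd (expo b (n + 1)) _))

lemma measurableSet_spacer (n i j : ℕ) : MeasurableSet (spacer b a n i j) := by
  have h1 : Measurable fun x : Skyscraper (spacersAbove b a) => x.1.1 :=
    measurable_fst.comp measurable_subtype_coe
  have h2 : Measurable fun x : Skyscraper (spacersAbove b a) => x.1.2 :=
    measurable_snd.comp measurable_subtype_coe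
  convert (h2 (measurableSet_singleton (j + 1))).inter (h1 (PadicInt.measurableSet_two_pow_dvd
    (expo b (n + 1)) (((i + 1 : ℕ) : ℤ_[2]) * 2 ^ expo b n - 1))) using 1
  ext x
  simp only [spacer, Set.mem_ofPred_eq, Set.mem_inter_iff, Set.mem_preimage,
    Set.mem_singleton_iff]
  rw [show x.1.1 + 1 - ((i + 1 : ℕ) : ℤ_[2]) * 2 ^ expo b n =
    x.1.1 - (((i + 1 : ℕ) : ℤ_[2]) * 2 ^ expo b n - 1) by ring]

lemma measurableSet_level (n k : ℕ) :
    MeasurableSet ((transformation b a)^[k] '' base b a n) := by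
  induction k with
  | zero => simpa using measurableSet_base n
  | succ k ih =>
    rw [Function.iterate_succ', Set.image_comp]
    exact (transformation b a).measurableSet_image.2 ih

lemma disjoint_levels {n k l : ℕ} (hk : k < hgt n) (hl : l < hgt n) (hkl : k ≠ l) :
    Disjoint ((transformation b a)^[k] '' base b a n) ((transformation b a)^[l] '' base b a n) := by
  wlog hlt : k < l generalizing k l
  · exact (this hl hk hkl.symm (by omega)).symm
  rw [Set.disjoint_left]
  rintro _ ⟨x, hx, rfl⟩ ⟨y, hy, hxy⟩
  rw [show l = k + (l - k) by omega, Function.iterate_add_apply] at hxy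
  have h1 := (transformation b a).injective.iterate k hxy
  obtain ⟨u, v, h2, h3⟩ := (towerClimb (b := b) (a := a) n).parallel (l - k) (by omega)
  have h4 := h3 y hy
  rw [h1] at h4
  refine h2 (by omega) ?_ ?_
  · rw [← hx.1, h4]
  · have h5 := hx.2
    rw [h4] at h5
    exact (dvd_add_right hy.2).1 h5

lemma image_top {n i : ℕ} (hi : i + 1 < 2 ^ b n) :
    (transformation b a)^[hgt n] '' cut b a n i =
      if a n i = 0 then cut b a n (i + 1) else spacer b a n i 0 := by
  have hpos := towerHeight_pos (a := a) (one_le_two_pow b) n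
  split_ifs with ha
  · have h1 := fun x hx => (towerClimb (a := a) n).iterate_next hi (x := x) hx
    rw [ha, add_zero] at h1
    ext y
    constructor
    · rintro ⟨x, hx, rfl⟩
      refine ⟨by rw [h1 x hx], ?_⟩
      rw [h1 x hx]
      convert hx.2 using 1
      push_cast
      ring
    · rintro ⟨h0, hy⟩
      let x : Skyscraper (spacersAbove b a) := ⟨(y.1.1 - 2 ^ expo b n, 0), Nat.zero_le _⟩
      have hx : x ∈ cut b a n i := by
        refine ⟨rfl, ?_⟩
        convert hy using 1
        simp only [x]
        push_cast
        ring
      refine ⟨x, hx, Subtype.ext ?_⟩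
      rw [h1 x hx]
      exact Prod.ext (by simp [x]) h0.symm
  · have h1 := fun x hx => (towerClimb (a := a) n).iterate_floor hi
      (Nat.one_le_iff_ne_zero.2 ha) (x := x) hx
    rw [Nat.sub_add_cancel hpos] at h1
    ext y
    constructor
    · rintro ⟨x, hx, rfl⟩
      refine ⟨by rw [h1 x hx], ?_⟩
      rw [h1 x hx]
      convert hx.2 using 1
      push_cast
      ring
    · rintro ⟨h0, hy⟩
      let x : Skyscraper (spacersAbove b a) := ⟨(y.1.1 + 1 - 2 ^ expo b n, 0), Nat.zero_le _⟩
      have hx : x ∈ cut b a n i := by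
        refine ⟨rfl, ?_⟩
        convert hy using 1
        simp only [x]
        push_cast
        ring
      refine ⟨x, hx, Subtype.ext ?_⟩
      rw [h1 x hx]
      exact Prod.ext (by simp [x]) h0.symm

lemma image_spacer {n i j : ℕ} (hi : i + 1 < 2 ^ b n) (hj : j < a n i) :
    (transformation b a) '' spacer b a n i j =
      if j + 1 = a n i then cut b a n (i + 1) else spacer b a n i (j + 1) := by
  have hρ : ∀ z : ℤ_[2], (2 : ℤ_[2]) ^ expo b (n + 1) ∣
      z + 1 - ((i + 1 : ℕ) : ℤ_[2]) * 2 ^ expo b n → spacersAbove b a z = a n i :=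
    fun z hz => IsColumnEnd.spacersAbove_eq (p := (n, i)) ⟨hi, hz⟩ a
  split_ifs with hja
  · have h1 : ∀ x ∈ spacer b a n i j, (transformation b a x).1 = (x.1.1 + 1, 0) := by
      rintro x ⟨h0, hx⟩
      exact Skyscraper.step_val_of_eq _ _ (by rw [h0, hρ _ hx, hja])
    ext y
    constructor
    · rintro ⟨x, hx, rfl⟩
      refine ⟨by rw [h1 x hx], ?_⟩
      rw [h1 x hx]
      exact hx.2
    · rintro ⟨h0, hy⟩
      have hy' : (2 : ℤ_[2]) ^ expo b (n + 1) ∣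
          y.1.1 - 1 + 1 - ((i + 1 : ℕ) : ℤ_[2]) * 2 ^ expo b n := by
        rwa [sub_add_cancel]
      let x : Skyscraper (spacersAbove b a) := ⟨(y.1.1 - 1, j + 1), by rw [hρ _ hy', hja]⟩
      have hx : x ∈ spacer b a n i j := ⟨rfl, hy'⟩
      refine ⟨x, hx, Subtype.ext ?_⟩
      rw [h1 x hx]
      exact Prod.ext (by simp [x]) h0.symm
  · have h1 : ∀ x ∈ spacer b a n i j, (transformation b a x).1 = (x.1.1, j + 2) := by
      rintro x ⟨h0, hx⟩
      rw [Skyscraper.step_val_of_lt, h0]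
      rw [h0, hρ _ hx]
      omega
    ext y
    constructor
    · rintro ⟨x, hx, rfl⟩
      refine ⟨by rw [h1 x hx], ?_⟩
      rw [h1 x hx]
      exact hx.2
    · rintro ⟨h0, hy⟩
      let x : Skyscraper (spacersAbove b a) := ⟨(y.1.1, j + 1), by rw [hρ _ hy]; exact hj⟩
      have hx : x ∈ spacer b a n i j := ⟨rfl, hy⟩
      refine ⟨x, hx, Subtype.ext ?_⟩
      rw [h1 x hx]
      exact Prod.ext rfl h0.symm

/-- The levels of all towers separate points: two points on the same level of the tower of index
`n` are on the same floor, and lie above base points that agree modulo `2 ^ expo b n`. -/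
lemma eq_of_forall_mem_level_iff (hb : ∀ n, 1 ≤ b n) {x y : Skyscraper (spacersAbove b a)}
    (h : ∀ n, ∀ k < hgt n, x ∈ (transformation b a)^[k] '' base b a n ↔
      y ∈ (transformation b a)^[k] '' base b a n) : x = y := by
  obtain ⟨n₀, hn₀⟩ := exists_mem_towerSet x
  have key : ∀ n ≥ n₀, (2 : ℤ_[2]) ^ expo b n ∣ x.1.1 - y.1.1 ∧ x.1.2 = y.1.2 := by
    intro n hn
    obtain ⟨k, hk, hx⟩ := towerSet_mono hn hn₀
    obtain ⟨y', hy', hy⟩ := (h n k hk).1 hx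
    obtain ⟨x', hx', hx⟩ := hx
    obtain ⟨u, v, -, huv⟩ := (towerClimb (a := a) n).parallel k hk
    rw [← hx, ← hy, huv _ hx', huv _ hy']
    refine ⟨?_, rfl⟩
    simpa using dvd_sub hx'.2 hy'.2
  exact Subtype.ext (Prod.ext
    (PadicInt.eq_of_forall_two_pow_dvd (le_expo hb) ⟨n₀, fun n hn => (key n hn).1⟩)
    (key n₀ le_rfl).2)

instance : StandardBorelSpace (Skyscraper (spacersAbove b a)) :=
  (Skyscraper.measurableSet_carrier (measurable_spacersAbove b a)).standardBorel

lemma isCutAndStack (hb : ∀ n, 1 ≤ b n)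
    (ha : Summable fun n => (spacerTotal (2 ^ b n) (a n) : ℝ) / (hgt (n + 1) : ℝ))
    (μ : Measure (Skyscraper (spacersAbove b a))) :
    IsCutAndStack μ (transformation b a) (fun n => 2 ^ b n) a (base b a) (cut b a)
      (spacer b a) where
  one_le_q := one_le_two_pow b
  summable_spacers := ha
  measurableSet_base := measurableSet_base
  measurableSet_cut n i _ := measurableSet_cut n i
  measurableSet_spacer n i j _ _ := measurableSet_spacer n i j
  disjoint_levels _ _ _ := disjoint_levels
  disjoint_cuts n i j hi hj hij := by
    rw [Set.disjoint_left]
    exact fun x hx hx' => hij (eq_of_mem_cut hi hj hx hx')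
  iUnion_cuts n := by
    ext x
    simp only [Set.mem_iUnion, Finset.mem_range, exists_prop]
    exact ⟨fun ⟨i, _, hx⟩ => cut_subset_base n i hx, exists_mem_cut⟩
  image_top _ _ := image_top
  image_spacer _ _ _ := image_spacer
  base_succ n := Set.ext fun _ => mem_cut_zero_iff.symm
  exhaust := by
    convert measure_empty (μ := μ)
    rw [Set.compl_empty_iff, Set.eq_univ_iff_forall]
    intro x
    obtain ⟨n, k, hk, hx⟩ := exists_mem_towerSet x
    simp only [Set.mem_iUnion, Finset.mem_range]
    exact ⟨n, k, hk, hx⟩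
  generate B hB := by
    refine ⟨B, ?_, ae_eq_refl _⟩
    rw [generateFrom_eq_of_countable_of_separating]
    · exact hB
    · have hr : {L : Set (Skyscraper (spacersAbove b a)) | ∃ n k, k < hgt n ∧
          L = (transformation b a)^[k] '' base b a n} ⊆
          Set.range fun p : ℕ × ℕ => (transformation b a)^[p.2] '' base b a p.1 := by
        rintro _ ⟨n, k, -, rfl⟩
        exact ⟨(n, k), rfl⟩
      exact (Set.countable_range _).mono hr
    · rintro _ ⟨n, k, -, rfl⟩
      exact measurableSet_level n k
    · intro x y h
      exact eq_of_forall_mem_level_iff hb fun n k hk => h _ ⟨n, k, hk, rfl⟩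

open scoped ENNReal in
/-- Existence of the rank one system with `2 ^ b n` columns and given spacers. -/
theorem exists_isCutAndStack (hb : ∀ n, 1 ≤ b n)
    (ha : Summable fun n => (spacerTotal (2 ^ b n) (a n) : ℝ) / 2 ^ expo b (n + 1)) :
    ∃ (X : Type) (_ : MeasurableSpace X) (_ : StandardBorelSpace X)
      (μ : Measure X) (_ : IsProbabilityMeasure μ) (T : X ≃ᵐ X),
      MeasurePreserving T μ μ ∧
      ∃ F Fc C, IsCutAndStack μ T (fun n => 2 ^ b n) a F Fc C := by
  let ν : Measure ℤ_[2] := Measure.addHaar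
  have hρ := measurable_spacersAbove b a
  have hS : MeasurePreserving (MeasurableEquiv.addRight (1 : ℤ_[2])) ν ν :=
    measurePreserving_add_right ν 1
  let μ₀ := Skyscraper.measure ν (spacersAbove b a)
  have h0 : μ₀ Set.univ ≠ 0 := by
    rw [Skyscraper.measure_univ hρ]
    refine (lt_of_lt_of_le ?_ (lintegral_mono (f := fun _ => 1) fun z => ?_)).ne'
    · rw [lintegral_one]
      exact isOpen_univ.measure_pos ν Set.univ_nonempty
    · simp
  have htop : μ₀ Set.univ ≠ ∞ := by
    rw [Skyscraper.measure_univ hρ]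
    push_cast
    rw [lintegral_add_right _ measurable_const, lintegral_one]
    refine ENNReal.add_ne_top.2 ⟨lintegral_spacersAbove_ne_top ν ?_, measure_ne_top ν _⟩
    convert ha.tsum_ofReal_ne_top using 4 with n
    rw [ENNReal.ofReal_div_of_pos (by positivity), ENNReal.ofReal_natCast,
      ENNReal.ofReal_pow (by norm_num)]
    simp
  refine ⟨Skyscraper (spacersAbove b a), inferInstance, inferInstance, (μ₀ Set.univ)⁻¹ • μ₀,
    ⟨?_⟩, transformation b a, ?_, base b a, cut b a, spacer b a, isCutAndStack hb ?_ _⟩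
  · rw [Measure.smul_apply, smul_eq_mul, ENNReal.inv_mul_cancel h0 htop]
  · exact (Skyscraper.measurePreserving_step hS hρ).smul_measure _
  · refine Summable.of_nonneg_of_le (fun n => by positivity) (fun n => ?_) ha
    have hle : ∀ n, 2 ^ expo b n ≤ hgt n := by
      intro n
      induction n with
      | zero => simp [expo, towerHeight]
      | succ n ih =>
        rw [expo_succ, pow_add, towerHeight, mul_comm]
        have := Nat.mul_le_mul_left (2 ^ b n) ih
        omega
    have := hle (n + 1)
    gcongr
    exact_mod_cast this

end Odometer

/-! ### A lower bound for Shannon entropy -/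

/-- If the atoms of the partition have small trace on a set `G` of large measure, then the partition
has large entropy: the atoms at least half contained in `G` are themselves small. -/
lemma le_shannonEntropy {X : Type*} [MeasurableSpace X] {μ : Measure X} [IsProbabilityMeasure μ]
    {ι : Type*} [Fintype ι] {φ : X → ι} (hφ : ∀ i, MeasurableSet (φ ⁻¹' {i})) {G : Set X}
    (hG : MeasurableSet G) {δ : ℝ} (hδ : 2 * δ ≤ 1)
    (h : ∀ i, μ.real (G ∩ φ ⁻¹' {i}) ≤ δ) :
    (2 * μ.real G - 1) * -Real.log (2 * δ) ≤ shannonEntropy μ φ := by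
  have hsum : ∀ A : Set X, MeasurableSet A → ∑ i, μ.real (A ∩ φ ⁻¹' {i}) = μ.real A := by
    intro A hA
    rw [← measureReal_biUnion_finset]
    · congr 1
      ext x
      simp
    · intro i _ j _ hij
      rw [Function.onFun, Set.disjoint_left]
      rintro x ⟨-, hx⟩ ⟨-, hx'⟩
      simp only [Set.mem_preimage, Set.mem_singleton_iff] at hx hx'
      exact hij (hx.symm.trans hx')
    · exact fun i _ => hA.inter (hφ i)
  have h1 : ∑ i, μ.real (φ ⁻¹' {i}) = 1 := by
    simpa using hsum Set.univ MeasurableSet.univ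
  have h0 : 0 ≤ δ := by
    by_contra hneg
    have h2 : ∀ i, μ.real (G ∩ φ ⁻¹' {i}) < 0 := fun i => (h i).trans_lt (not_le.1 hneg)
    have : IsEmpty ι := ⟨fun i => absurd measureReal_nonneg (h2 i).not_ge⟩
    simp at h1
  have hlog : 0 ≤ -Real.log (2 * δ) := by
    have := Real.log_nonpos (by linarith) hδ
    linarith
  rw [shannonEntropy, ← hsum G hG, ← h1, Finset.mul_sum, ← Finset.sum_sub_distrib,
    Finset.sum_mul]
  refine Finset.sum_le_sum fun i _ => ?_
  set p := μ.real (φ ⁻¹' {i})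
  set g := μ.real (G ∩ φ ⁻¹' {i})
  have hgp : g ≤ p := measureReal_mono Set.inter_subset_right
  have hg0 : 0 ≤ g := measureReal_nonneg
  have hp1 : p ≤ 1 := measureReal_le_one
  rcases lt_or_ge (2 * g) p with hlt | hge
  · exact (mul_nonpos_of_nonpos_of_nonneg (by linarith) hlog).trans
      (Real.negMulLog_nonneg (by linarith) hp1)
  · rcases hg0.eq_or_lt with hg | hg
    · have hp : p = 0 := by linarith
      rw [← hg, hp]
      simp
    · have hpδ : p ≤ 2 * δ := by linarith [h i]
      have h3 : Real.log p ≤ Real.log (2 * δ) := Real.log_le_log (by linarith) hpδ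
      rw [Real.negMulLog]
      nlinarith

/-! ### Names read along a random sequence of spacers -/

/-- The symbol at time `τ` of the name formed by `M` blocks. Each block consists of `L` copies of
the word `σ 0, …, σ (h - 1)`, followed by a number of symbols `o`; these numbers are the
base-`R` digits of `W`, the lowest digit being used first. After the `M` blocks the name is `o`. -/
def blockName {ι : Type*} (σ : ℕ → ι) (o : ι) (h L R : ℕ) : ℕ → ℕ → ℕ → ι
  | 0, _, _ => o
  | M + 1, W, τ =>
    if τ < L * h then σ (τ % h)
    else if τ < L * h + W % R then o
    else blockName σ o h L R M (W / R) (τ - (L * h + W % R))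

lemma blockName_succ_of_le {ι : Type*} {σ : ℕ → ι} {o : ι} {h L R M W τ : ℕ}
    (hτ : L * h + W % R ≤ τ) :
    blockName σ o h L R (M + 1) W τ = blockName σ o h L R M (W / R) (τ - (L * h + W % R)) := by
  rw [blockName, if_neg (by omega), if_neg (by omega)]

/-- The lowest digit and the remaining digits of a number in base `R` are independent. -/
lemma sum_range_pow_succ_mod_div {R M : ℕ} (hR : 0 < R) (f : ℕ → ℕ → ℝ) :
    ∑ W ∈ Finset.range (R ^ (M + 1)), f (W % R) (W / R) =
      ∑ s ∈ Finset.range R, ∑ W ∈ Finset.range (R ^ M), f s W := by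
  rw [← Finset.sum_product']
  refine Finset.sum_nbij' (fun W => (W % R, W / R)) (fun p => p.1 + R * p.2) ?_ ?_ ?_ ?_ ?_
  · intro W hW
    simp only [Finset.mem_range, Finset.mem_product] at hW ⊢
    exact ⟨Nat.mod_lt _ hR, Nat.div_lt_of_lt_mul (by rwa [pow_succ'] at hW)⟩
  · rintro ⟨s, W⟩ hp
    simp only [Finset.mem_range, Finset.mem_product] at hp ⊢
    calc s + R * W < R + R * W := by omega
      _ = R * (W + 1) := by ring
      _ ≤ R * R ^ M := Nat.mul_le_mul_left _ hp.2
      _ = R ^ (M + 1) := (pow_succ' _ _).symm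
  · intro W _
    exact Nat.mod_add_div W R
  · rintro ⟨s, W⟩ hp
    simp only [Finset.mem_range, Finset.mem_product] at hp
    simp [Nat.add_mul_mod_self_left, Nat.mod_eq_of_lt hp.1, Nat.add_mul_div_left _ _ hR,
      Nat.div_eq_of_lt hp.1]
  · intro W _
    rfl

section Window

variable {ι : Type*} [DecidableEq ι] {σ : ℕ → ι} {o y : ι} {h L R κ : ℕ}

/-- Consecutive positions, at most `h` of them, have distinct residues modulo `h`. -/
lemma card_filter_window_le (hκ : (Finset.filter (fun k => σ k = y) (Finset.range h)).card ≤ κ)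
    (hh : 0 < h) (hRh : R ≤ h) (x : ℕ) {S : Finset ℕ} (hS : ∀ s ∈ S, s < R ∧ s ≤ x)
    (hy : ∀ s ∈ S, σ ((x - s) % h) = y) : S.card ≤ κ := by
  refine (Finset.card_le_card_of_injOn (fun s => (x - s) % h) ?_ ?_).trans hκ
  · intro s hs
    simp only [Finset.coe_filter, Finset.mem_range, Set.mem_ofPred_eq]
    exact ⟨Nat.mod_lt _ hh, hy s hs⟩
  · have key : ∀ s ∈ S, ∀ s' ∈ S, s < s' → (x - s) % h ≠ (x - s') % h := by
      intro s hs s' hs' hlt heq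
      have h1 := (Nat.modEq_iff_dvd' (by omega)).1 (show (x - s') ≡ (x - s) [MOD h] from heq.symm)
      have h2 := Nat.le_of_dvd (by have := hS s hs; have := hS s' hs'; omega) h1
      have := hS s hs
      have := hS s' hs'
      omega
    intro s hs s' hs' heq
    rcases lt_trichotomy s s' with hlt | rfl | hlt
    · exact absurd heq (key s hs s' hs' hlt)
    · rfl
    · exact absurd heq.symm (key s' hs' s hs hlt)

/-- A window of length `R ≤ h` meets at most one run of spacers, so it shows each level of the tower
of height `h` at most twice. -/
lemma card_window_blockName_le
    (hκ : (Finset.filter (fun k => σ k = y) (Finset.range h)).card ≤ κ)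
    (hyo : y ≠ o) (hh : 0 < h) (hL : 0 < L) (hRh : R ≤ h) (M W x : ℕ) (hx : R ≤ x + 1) :
    (Finset.filter (fun s => blockName σ o h L R M W (x - s) = y) (Finset.range R)).card
      ≤ 2 * κ := by
  have hLh : h ≤ L * h := Nat.le_mul_of_pos_left h hL
  induction M generalizing W x with
  | zero => simp [blockName, hyo.symm]
  | succ M ih =>
    by_cases hall : L * h + W % R + R ≤ x + 1
    · have hxs := ih (W / R) (x - (L * h + W % R)) (by omega)
      refine le_trans (Finset.card_le_card ?_) hxs
      intro s hs
      simp only [Finset.mem_filter, Finset.mem_range] at hs ⊢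
      refine ⟨hs.1, ?_⟩
      have h2 := hs.2
      rw [blockName, if_neg (by omega), if_neg (by omega)] at h2
      rw [← h2]
      congr 1
      omega
    · -- the part of the window before the spacers, and the part after them
      set A := Finset.filter (fun s => x - s < L * h ∧ σ ((x - s) % h) = y) (Finset.range R)
      set B := Finset.filter (fun s => s ≤ x - (L * h + W % R) ∧ L * h + W % R ≤ x ∧
        σ ((x - (L * h + W % R) - s) % h) = y) (Finset.range R)
      have hsub : Finset.filter (fun s => blockName σ o h L R (M + 1) W (x - s) = y)
          (Finset.range R) ⊆ A ∪ B := by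
        intro s hs
        simp only [Finset.mem_filter, Finset.mem_range, Finset.mem_union, A, B] at hs ⊢
        obtain ⟨hs, h2⟩ := hs
        rw [blockName] at h2
        split_ifs at h2 with h3 h4
        · exact Or.inl ⟨hs, h3, h2⟩
        · exact absurd h2.symm hyo
        · right
          refine ⟨hs, by omega, by omega, ?_⟩
          rcases M with _ | M
          · exact absurd h2.symm hyo
          · rw [blockName, if_pos (by omega)] at h2
            rw [← h2]
            congr 2
            omega
      have hA : A.card ≤ κ := by
        refine card_filter_window_le hκ hh hRh x (fun s hs => ?_) fun s hs => ?_
        · simp only [A, Finset.mem_filter, Finset.mem_range] at hs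
          exact ⟨hs.1, by omega⟩
        · exact (Finset.mem_filter.1 hs).2.2
      have hB : B.card ≤ κ := by
        refine card_filter_window_le hκ hh hRh (x - (L * h + W % R)) (fun s hs => ?_)
          fun s hs => ?_
        · simp only [B, Finset.mem_filter, Finset.mem_range] at hs
          exact ⟨hs.1, hs.2.1⟩
        · exact (Finset.mem_filter.1 hs).2.2.2
      calc _ ≤ (A ∪ B).card := Finset.card_le_card hsub
        _ ≤ A.card + B.card := Finset.card_union_le _ _
        _ ≤ 2 * κ := by omega

end Window

section Count

/-- The number of `W < R ^ M` whose name, read at the times `u k - c` for `k₁ ≤ k < N`, is `w`. -/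
def matchCount {ι : Type*} [DecidableEq ι] (σ : ℕ → ι) (o : ι) (h L R N : ℕ) (u : ℕ → ℕ) (w : ℕ → ι)
    (M k₁ c : ℕ) : ℝ :=
  ∑ W ∈ Finset.range (R ^ M),
    if ∀ k, k₁ ≤ k → k < N → blockName σ o h L R M W (u k - c) = w k then 1 else 0

variable {ι : Type*} [DecidableEq ι] {σ : ℕ → ι} {o : ι} {h L R N : ℕ} {u : ℕ → ℕ} {w : ℕ → ι}
  {β : ι → ℝ} {k₀ : ℕ}

/-- The bound for reading `w` at the times `u k - c`, `k₁ ≤ k < N`, when the first of them is at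
least one block length past the start and the last is before the end of the `M` blocks: the symbols are
read as if independent, `y` having probability at most `β y`. -/
def TailBound (σ : ℕ → ι) (o : ι) (h L R N : ℕ) (u : ℕ → ℕ) (w : ℕ → ι) (β : ι → ℝ)
    (k₁ : ℕ) : Prop :=
  ∀ M c, (k₁ < N → c + (L * h + R) ≤ u k₁) → (∀ k, k₁ ≤ k → k < N → u k < c + M * (L * h)) →
    matchCount σ o h L R N u w M k₁ c ≤ (R : ℝ) ^ M * ∏ k ∈ Finset.Ico k₁ N, β (w k)

/-- Given the symbol at the time `u k₁ - c`, the later symbols are still random: between two of the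
times there is a spacer that the earlier symbols do not determine. -/
lemma matchCount_le_of_tailBound (hβ : ∀ y, 0 ≤ β y) (hR : 0 < R) {k₁ : ℕ} (hk : k₁ < N)
    (hgap : ∀ k ≥ k₁, u k + 2 * (L * h + R) ≤ u (k + 1))
    (htail : TailBound σ o h L R N u w β (k₁ + 1)) (M c : ℕ) (hc : c ≤ u k₁)
    (hu : ∀ k, k₁ ≤ k → k < N → u k < c + M * (L * h)) :
    matchCount σ o h L R N u w M k₁ c ≤ (∏ k ∈ Finset.Ico (k₁ + 1) N, β (w k)) *
      ∑ W ∈ Finset.range (R ^ M),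
        if blockName σ o h L R M W (u k₁ - c) = w k₁ then (1 : ℝ) else 0 := by
  have hmono : ∀ k ≥ k₁, u k₁ ≤ u k := by
    intro k hk
    induction k, hk using Nat.le_induction with
    | base => rfl
    | succ k hk ih => have := hgap k hk; omega
  have hP : 0 ≤ ∏ k ∈ Finset.Ico (k₁ + 1) N, β (w k) := Finset.prod_nonneg fun k _ => hβ _
  induction M generalizing c with
  | zero => exact absurd (hu k₁ le_rfl hk) (by omega)
  | succ M ih =>
    have hrange : ∀ s, ∀ k, k₁ ≤ k → k < N → u k < (c + (L * h + s)) + M * (L * h) := by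
      intro s k h1 h2
      have := hu k h1 h2
      rw [Nat.succ_mul] at this
      omega
    have hdm : ∀ {s W : ℕ}, s < R → (s + R * W) % R = s ∧ (s + R * W) / R = W := by
      intro s W hs
      rw [Nat.add_mul_mod_self_left, Nat.mod_eq_of_lt hs, Nat.add_mul_div_left _ _ hR,
        Nat.div_eq_of_lt hs, zero_add]
      exact ⟨rfl, rfl⟩
    have hl := sum_range_pow_succ_mod_div (M := M) hR fun s W =>
      if ∀ k, k₁ ≤ k → k < N → blockName σ o h L R (M + 1) (s + R * W) (u k - c) = w k
      then (1 : ℝ) else 0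
    have hr := sum_range_pow_succ_mod_div (M := M) hR fun s W =>
      if blockName σ o h L R (M + 1) (s + R * W) (u k₁ - c) = w k₁ then (1 : ℝ) else 0
    simp only [Nat.mod_add_div] at hl hr
    rw [matchCount, hl, hr, Finset.mul_sum]
    refine Finset.sum_le_sum fun s hs => ?_
    have hsR : s < R := Finset.mem_range.1 hs
    have hshift : ∀ W k, c + (L * h + s) ≤ u k →
        blockName σ o h L R (M + 1) (s + R * W) (u k - c) =
          blockName σ o h L R M W (u k - (c + (L * h + s))) := by
      intro W k hk
      rw [blockName_succ_of_le, (hdm hsR).1, (hdm hsR).2]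
      · congr 1
        omega
      · rw [(hdm hsR).1]
        omega
    by_cases hs' : c + (L * h + s) ≤ u k₁
    · have := ih (c + (L * h + s)) hs' (hrange s)
      rw [matchCount] at this
      refine (le_of_eq ?_).trans (this.trans (le_of_eq ?_))
      · refine Finset.sum_congr rfl fun W _ => ?_
        congr 1
        refine propext (forall_congr' fun k => forall_congr' fun h1 => ?_)
        rw [hshift W k (hs'.trans (hmono k h1))]
      · congr 1
        refine Finset.sum_congr rfl fun W _ => ?_
        rw [hshift W k₁ hs']
    · -- the first symbol is determined by `s` alone
      have hconst : ∀ W, blockName σ o h L R (M + 1) (s + R * W) (u k₁ - c) =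
          blockName σ o h L R (M + 1) s (u k₁ - c) := by
        intro W
        rw [blockName, blockName, (hdm hsR).1, Nat.mod_eq_of_lt hsR]
        split_ifs
        · rfl
        · rfl
        · omega
      by_cases hv : blockName σ o h L R (M + 1) s (u k₁ - c) = w k₁
      · have h2 := htail M (c + (L * h + s)) (fun _ => by have := hgap k₁ le_rfl; omega)
          (fun k h1 h2 => hrange s k (by omega) h2)
        simp only [hconst, hv, if_true, Finset.sum_const, Finset.card_range, nsmul_eq_mul,
          mul_one]
        rw [mul_comm]
        push_cast
        refine le_trans (Finset.sum_le_sum fun W _ => ?_) h2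
        by_cases hm : ∀ k, k₁ ≤ k → k < N →
          blockName σ o h L R (M + 1) (s + R * W) (u k - c) = w k
        · rw [if_pos hm, if_pos]
          intro k h1 h2
          rw [← hm k (by omega) h2, hshift]
          have h3 := hgap k₁ le_rfl
          have h4 : u (k₁ + 1) ≤ u k := by
            have : ∀ k ≥ k₁ + 1, u (k₁ + 1) ≤ u k := by
              intro k hk
              induction k, hk using Nat.le_induction with
              | base => rfl
              | succ k hk ih => have := hgap k (by omega); omega
            exact this k h1
          omega
        · rw [if_neg hm]
          split_ifs <;> norm_num
      · have h0 : ∀ W, ¬ ∀ k, k₁ ≤ k → k < N →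
            blockName σ o h L R (M + 1) (s + R * W) (u k - c) = w k :=
          fun W hm => hv ((hconst W).symm.trans (hm k₁ le_rfl hk))
        simp [hconst, hv, h0]

/-- The symbol at the time `u k₁ - c` is itself random: for fixed later spacers, the first number of
spacers moves the position through a window of length `R`. -/
lemma tailBound_of_succ (hβ : ∀ y, 0 ≤ β y) (hR : 0 < R)
    (hwin : ∀ y M W x, R ≤ x + 1 → ((Finset.filter
      (fun s => blockName σ o h L R M W (x - s) = y) (Finset.range R)).card : ℝ) ≤ R * β y)
    {k₁ : ℕ} (hk : k₁ < N) (hgap : ∀ k ≥ k₁, u k + 2 * (L * h + R) ≤ u (k + 1))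
    (htail : TailBound σ o h L R N u w β (k₁ + 1)) : TailBound σ o h L R N u w β k₁ := by
  intro M c hc hu
  have hc := hc hk
  have hmono : ∀ k ≥ k₁, u k₁ ≤ u k := by
    intro k hk
    induction k, hk using Nat.le_induction with
    | base => rfl
    | succ k hk ih => have := hgap k hk; omega
  rcases M with _ | M
  · exact absurd (hu k₁ le_rfl hk) (by omega)
  have hl := sum_range_pow_succ_mod_div (M := M) hR fun s W =>
    if ∀ k, k₁ ≤ k → k < N → blockName σ o h L R (M + 1) (s + R * W) (u k - c) = w k
    then (1 : ℝ) else 0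
  simp only [Nat.mod_add_div] at hl
  rw [matchCount, hl]
  set P := ∏ k ∈ Finset.Ico (k₁ + 1) N, β (w k) with hPdef
  have hP : 0 ≤ P := Finset.prod_nonneg fun k _ => hβ _
  have hstep : ∀ s ∈ Finset.range R, ∑ W ∈ Finset.range (R ^ M),
      (if ∀ k, k₁ ≤ k → k < N → blockName σ o h L R (M + 1) (s + R * W) (u k - c) = w k
        then (1 : ℝ) else 0) ≤
      P * ∑ W ∈ Finset.range (R ^ M),
        if blockName σ o h L R M W (u k₁ - (c + (L * h + s))) = w k₁ then (1 : ℝ) else 0 := by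
    intro s hs
    have hsR : s < R := Finset.mem_range.1 hs
    have := matchCount_le_of_tailBound hβ hR hk hgap htail M (c + (L * h + s)) (by omega)
      (fun k h1 h2 => by have := hu k h1 h2; rw [Nat.succ_mul] at this; omega)
    refine le_trans (le_of_eq ?_) this
    refine Finset.sum_congr rfl fun W _ => ?_
    congr 1
    refine propext (forall_congr' fun k => forall_congr' fun h1 => ?_)
    have h2 := hmono k h1
    have hm : (s + R * W) % R = s := by rw [Nat.add_mul_mod_self_left, Nat.mod_eq_of_lt hsR]
    have hd : (s + R * W) / R = W := by
      rw [Nat.add_mul_div_left _ _ hR, Nat.div_eq_of_lt hsR, zero_add]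
    rw [blockName_succ_of_le (by omega), hm, hd,
      show u k - c - (L * h + s) = u k - (c + (L * h + s)) by omega]
  refine (Finset.sum_le_sum hstep).trans ?_
  rw [← Finset.mul_sum, Finset.sum_comm]
  have hW : ∀ W ∈ Finset.range (R ^ M), ∑ s ∈ Finset.range R,
      (if blockName σ o h L R M W (u k₁ - (c + (L * h + s))) = w k₁ then (1 : ℝ) else 0) ≤
      R * β (w k₁) := by
    intro W _
    rw [Finset.sum_boole]
    have he : ∀ s, u k₁ - (c + (L * h + s)) = u k₁ - (c + L * h) - s := fun s => by omega
    simp only [he]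
    exact hwin (w k₁) M W (u k₁ - (c + L * h)) (by omega)
  refine (mul_le_mul_of_nonneg_left (Finset.sum_le_sum hW) hP).trans (le_of_eq ?_)
  rw [Finset.sum_const, Finset.card_range, nsmul_eq_mul, Finset.prod_eq_prod_Ico_succ_bot hk,
    ← hPdef]
  push_cast
  ring

lemma tailBound (hβ : ∀ y, 0 ≤ β y) (hR : 0 < R)
    (hwin : ∀ y M W x, R ≤ x + 1 → ((Finset.filter
      (fun s => blockName σ o h L R M W (x - s) = y) (Finset.range R)).card : ℝ) ≤ R * β y)
    (hgap : ∀ k ≥ k₀, u k + 2 * (L * h + R) ≤ u (k + 1)) (hk : k₀ ≤ N) :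
    TailBound σ o h L R N u w β k₀ := by
  induction hk using Nat.decreasingInduction with
  | self =>
    intro M c _ _
    rw [matchCount, Finset.Ico_self, Finset.prod_empty, mul_one]
    refine (Finset.sum_le_sum (g := fun _ => (1 : ℝ)) fun W _ => ?_).trans ?_
    · split_ifs <;> norm_num
    · simp
  | of_succ k hk ih =>
    exact tailBound_of_succ hβ hR hwin hk hgap (ih fun k' hk' => hgap k' (by omega))

end Count

/-! ### Towers of a cut-and-stack system -/

namespace IsCutAndStack

variable {X : Type*} [MeasurableSpace X] {μ : Measure X} {T : X ≃ᵐ X} {q : ℕ → ℕ}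
  {a : ℕ → ℕ → ℕ} {F : ℕ → Set X} {Fc : ℕ → ℕ → Set X} {C : ℕ → ℕ → ℕ → Set X}

lemma cut_subset (H : IsCutAndStack μ T q a F Fc C) {n i : ℕ} (hi : i < q n) : Fc n i ⊆ F n := by
  rw [← H.iUnion_cuts n]
  exact Set.subset_biUnion_of_mem (u := Fc n) (by simpa using hi)

lemma image_spacer_level (H : IsCutAndStack μ T q a F Fc C) {n i j : ℕ} (hi : i + 1 < q n)
    (hj : j < a n i) : T^[towerHeight q a n + j] '' Fc n i = C n i j := by
  induction j with
  | zero => rw [add_zero, H.image_top n i hi, if_neg (by omega)]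
  | succ j ih =>
    rw [← add_assoc, Function.iterate_succ', Set.image_comp, ih (by omega),
      H.image_spacer n i j hi (by omega), if_neg (by omega)]

lemma image_next_cut (H : IsCutAndStack μ T q a F Fc C) {n i : ℕ} (hi : i + 1 < q n) :
    T^[towerHeight q a n + a n i] '' Fc n i = Fc n (i + 1) := by
  rcases Nat.eq_zero_or_pos (a n i) with ha | ha
  · rw [ha, add_zero, H.image_top n i hi, if_pos ha]
  · obtain ⟨j, hj⟩ := Nat.exists_eq_add_of_lt ha
    rw [zero_add] at hj
    rw [hj, ← add_assoc, Function.iterate_succ', Set.image_comp,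
      H.image_spacer_level hi (by omega), H.image_spacer n i j hi (by omega), if_pos hj.symm]

lemma image_columnStart (H : IsCutAndStack μ T q a F Fc C) {n i : ℕ} (hi : i < q n) :
    T^[columnStart q a n i] '' F (n + 1) = Fc n i := by
  induction i with
  | zero => rw [columnStart_zero, H.base_succ n, Function.iterate_zero, Set.image_id]
  | succ i ih =>
    rw [columnStart_succ, add_comm, Function.iterate_add, Set.image_comp, ih (by omega),
      H.image_next_cut hi]

lemma image_columnStart_add (H : IsCutAndStack μ T q a F Fc C) {n i : ℕ} (hi : i < q n) (k : ℕ) :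
    T^[columnStart q a n i + k] '' F (n + 1) = T^[k] '' Fc n i := by
  rw [add_comm, Function.iterate_add, Set.image_comp, H.image_columnStart hi]

lemma columnStart_add_lt (H : IsCutAndStack μ T q a F Fc C) {n i k : ℕ} (hi : i < q n)
    (hk : k < towerHeight q a n) : columnStart q a n i + k < towerHeight q a (n + 1) := by
  rw [towerHeight_succ_eq_columnStart a H.one_le_q]
  have : columnStart q a n i ≤ columnStart q a n (q n - 1) :=
    monotone_nat_of_le_succ (fun i => by rw [columnStart_succ]; omega) (by omega)
  omega

end IsCutAndStack

/-- The union of the levels `B, T B, …, T^(h - 1) B`. -/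
def towerUnion {X : Type*} (T : X → X) (B : Set X) (h : ℕ) : Set X :=
  {x | ∃ k < h, x ∈ T^[k] '' B}

namespace IsCutAndStack

variable {X : Type*} [MeasurableSpace X] {μ : Measure X} {T : X ≃ᵐ X} {q : ℕ → ℕ}
  {a : ℕ → ℕ → ℕ} {F : ℕ → Set X} {Fc : ℕ → ℕ → Set X} {C : ℕ → ℕ → ℕ → Set X}

lemma exists_columnStart_of_mem (H : IsCutAndStack μ T q a F Fc C) {n k : ℕ} {x : X}
    (hx : x ∈ T^[k] '' F n) :
    ∃ i < q n, x ∈ T^[columnStart q a n i + k] '' F (n + 1) := by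
  obtain ⟨y, hy, rfl⟩ := hx
  rw [← H.iUnion_cuts n] at hy
  simp only [Set.mem_iUnion, Finset.mem_range, exists_prop] at hy
  obtain ⟨i, hi, hy⟩ := hy
  refine ⟨i, hi, ?_⟩
  rw [H.image_columnStart_add hi]
  exact ⟨y, hy, rfl⟩

lemma towerUnion_mono (H : IsCutAndStack μ T q a F Fc C) :
    Monotone fun n => towerUnion T (F n) (towerHeight q a n) := by
  refine monotone_nat_of_le_succ fun n => ?_
  rintro x ⟨k, hk, hx⟩
  obtain ⟨i, hi, hx⟩ := H.exists_columnStart_of_mem hx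
  exact ⟨_, H.columnStart_add_lt hi hk, hx⟩

lemma disjoint_spacer_towerUnion (H : IsCutAndStack μ T q a F Fc C) {n i j : ℕ} (hi : i + 1 < q n)
    (hj : j < a n i) : Disjoint (C n i j) (towerUnion T (F n) (towerHeight q a n)) := by
  rw [Set.disjoint_left]
  rintro x hx ⟨k, hk, hx'⟩
  rw [← H.image_spacer_level hi hj, ← H.image_columnStart_add (by omega)] at hx
  obtain ⟨i', hi', hx'⟩ := H.exists_columnStart_of_mem hx'
  have hmono : Monotone (columnStart q a n) :=
    monotone_nat_of_le_succ fun i => by rw [columnStart_succ]; omega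
  have h1 := columnStart_succ q a n i
  have h2 : columnStart q a n i + (towerHeight q a n + j) < towerHeight q a (n + 1) := by
    have := H.columnStart_add_lt hi (towerHeight_pos (a := a) H.one_le_q n)
    omega
  have h3 := H.columnStart_add_lt hi' hk
  refine Set.disjoint_left.1 (H.disjoint_levels (n + 1) _ _ h2 h3 ?_) hx hx'
  rcases le_or_gt i' i with hle | hlt
  · have := hmono hle
    omega
  · have := hmono (Nat.succ_le_of_lt hlt)
    rw [Nat.succ_eq_add_one] at this
    omega

/-- A level of a tower lies in a level of every earlier tower, or misses that tower. -/
lemma level_subset_or_disjoint (H : IsCutAndStack μ T q a F Fc C) {m n : ℕ} (hmn : m ≤ n) :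
    ∀ k < towerHeight q a n, (∃ l < towerHeight q a m, T^[k] '' F n ⊆ T^[l] '' F m) ∨
      Disjoint (T^[k] '' F n) (towerUnion T (F m) (towerHeight q a m)) := by
  induction n, hmn using Nat.le_induction with
  | base => exact fun k hk => Or.inl ⟨k, hk, subset_rfl⟩
  | succ n hmn ih =>
    intro k hk
    refine towerHeight_succ_induction (P := fun k =>
      (∃ l < towerHeight q a m, T^[k] '' F (n + 1) ⊆ T^[l] '' F m) ∨
      Disjoint (T^[k] '' F (n + 1)) (towerUnion T (F m) (towerHeight q a m)))
      H.one_le_q ?_ ?_ hk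
    · intro i k hi hk
      rw [H.image_columnStart_add hi]
      have hsub := Set.image_mono (f := T^[k]) (H.cut_subset hi)
      rcases ih k hk with ⟨l, hl, h⟩ | h
      · exact Or.inl ⟨l, hl, hsub.trans h⟩
      · exact Or.inr (h.mono_left hsub)
    · intro i j hi hj
      right
      rw [H.image_columnStart_add (by omega), H.image_spacer_level hi hj]
      exact (H.disjoint_spacer_towerUnion hi hj).mono_right (H.towerUnion_mono hmn)

lemma measurableSet_level (H : IsCutAndStack μ T q a F Fc C) (n k : ℕ) :
    MeasurableSet (T^[k] '' F n) := by
  induction k with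
  | zero => simpa using H.measurableSet_base n
  | succ k ih =>
    rw [Function.iterate_succ', Set.image_comp]
    exact T.measurableSet_image.2 ih

lemma measurableSet_towerUnion (H : IsCutAndStack μ T q a F Fc C) (n : ℕ) :
    MeasurableSet (towerUnion T (F n) (towerHeight q a n)) := by
  have : towerUnion T (F n) (towerHeight q a n) =
      ⋃ k ∈ Finset.range (towerHeight q a n), T^[k] '' F n := by
    ext x
    simp only [towerUnion, Set.mem_ofPred_eq, Set.mem_iUnion, Finset.mem_range, exists_prop]
  rw [this]
  exact Finset.measurableSet_biUnion _ fun k _ => H.measurableSet_level n k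

lemma measureReal_level (H : IsCutAndStack μ T q a F Fc C) (hT : MeasurePreserving T μ μ)
    (n k : ℕ) : μ.real (T^[k] '' F n) = μ.real (F n) := by
  have h1 := (hT.iterate k).measure_preimage (H.measurableSet_level n k).nullMeasurableSet
  rw [Set.preimage_image_eq _ (T.injective.iterate k)] at h1
  rw [Measure.real, Measure.real, h1]

/-- The measure of a union of distinct levels of one tower. -/
lemma measureReal_biUnion_level [IsFiniteMeasure μ] (H : IsCutAndStack μ T q a F Fc C)
    (hT : MeasurePreserving T μ μ) {n : ℕ} {ι : Type*} {s : Finset ι} {f : ι → ℕ}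
    (hf : ∀ i ∈ s, f i < towerHeight q a n) (hinj : Set.InjOn f s) :
    μ.real (⋃ i ∈ s, T^[f i] '' F n) = s.card * μ.real (F n) := by
  rw [measureReal_biUnion_finset]
  · rw [Finset.sum_congr rfl fun i _ => H.measureReal_level hT n (f i), Finset.sum_const,
      nsmul_eq_mul]
  · intro i hi j hj hij
    exact H.disjoint_levels n _ _ (hf i hi) (hf j hj) fun h => hij (hinj hi hj h)
  · exact fun i _ => H.measurableSet_level n _

lemma measureReal_towerUnion [IsFiniteMeasure μ] (H : IsCutAndStack μ T q a F Fc C)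
    (hT : MeasurePreserving T μ μ) (n : ℕ) :
    μ.real (towerUnion T (F n) (towerHeight q a n)) = towerHeight q a n * μ.real (F n) := by
  have := H.measureReal_biUnion_level hT (n := n) (s := Finset.range (towerHeight q a n))
    (f := id) (fun i hi => Finset.mem_range.1 hi) Function.injective_id.injOn
  rw [Finset.card_range] at this
  rw [← this]
  congr 1
  ext x
  simp only [towerUnion, Set.mem_ofPred_eq, Set.mem_iUnion, Finset.mem_range, exists_prop, id]

lemma measureReal_base_succ [IsFiniteMeasure μ] (H : IsCutAndStack μ T q a F Fc C)
    (hT : MeasurePreserving T μ μ) (n : ℕ) : μ.real (F n) = q n * μ.real (F (n + 1)) := by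
  have hinj : Function.Injective (columnStart q a n) := by
    refine (strictMono_nat_of_lt_succ fun i => ?_).injective
    have := towerHeight_pos (a := a) H.one_le_q n
    rw [columnStart_succ]
    omega
  have := H.measureReal_biUnion_level hT (n := n + 1) (s := Finset.range (q n))
    (f := columnStart q a n) (fun i hi => H.columnStart_add_lt (Finset.mem_range.1 hi)
      (towerHeight_pos (a := a) H.one_le_q n)) hinj.injOn
  rw [Finset.card_range] at this
  rw [← this, ← H.iUnion_cuts n]
  congr 1
  exact Set.iUnion₂_congr fun i hi => (H.image_columnStart (Finset.mem_range.1 hi)).symm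

lemma tendsto_measureReal_towerUnion [IsProbabilityMeasure μ] (H : IsCutAndStack μ T q a F Fc C) :
    Tendsto (fun n => μ.real (towerUnion T (F n) (towerHeight q a n))) atTop (nhds 1) := by
  have h1 := tendsto_measure_iUnion_atTop (μ := μ) H.towerUnion_mono
  have h2 : (⋃ n, ⋃ k ∈ Finset.range (towerHeight q a n), T^[k] '' F n) =
      ⋃ n, towerUnion T (F n) (towerHeight q a n) := by
    ext x
    simp only [towerUnion, Set.mem_ofPred_eq, Set.mem_iUnion, Finset.mem_range, exists_prop]
  have h3 : μ (⋃ n, towerUnion T (F n) (towerHeight q a n)) = 1 := by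
    have := H.exhaust
    rw [h2] at this
    rw [← prob_compl_eq_zero_iff (MeasurableSet.iUnion H.measurableSet_towerUnion)]
    exact this
  rw [h3] at h1
  have := (ENNReal.tendsto_toReal ENNReal.one_ne_top).comp h1
  rwa [ENNReal.toReal_one] at this

end IsCutAndStack

/-! ### The partition into the levels of a tower -/

open Classical in
/-- The coding function of the partition into the levels of a tower of height `h` with base `B`, and
the complement of the tower, which gets the last symbol. -/
def levelCode {X : Type*} (T : X → X) (B : Set X) (h : ℕ) (x : X) : Fin (h + 1) :=
  if hx : ∃ k : Fin h, x ∈ T^[k] '' B then hx.choose.castSucc else Fin.last h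

namespace IsCutAndStack

variable {X : Type*} [MeasurableSpace X] {μ : Measure X} {T : X ≃ᵐ X} {q : ℕ → ℕ}
  {a : ℕ → ℕ → ℕ} {F : ℕ → Set X} {Fc : ℕ → ℕ → Set X} {C : ℕ → ℕ → ℕ → Set X}

lemma levelCode_eq_castSucc_iff (H : IsCutAndStack μ T q a F Fc C) {m : ℕ} {x : X}
    (k : Fin (towerHeight q a m)) :
    levelCode T (F m) (towerHeight q a m) x = k.castSucc ↔ x ∈ T^[k] '' F m := by
  constructor
  · intro h
    rw [levelCode] at h
    split_ifs at h with hx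
    · have := hx.choose_spec
      rwa [Fin.castSucc_injective _ h] at this
    · exact absurd h (Fin.castSucc_lt_last k).ne'
  · intro h
    have hx : ∃ k : Fin (towerHeight q a m), x ∈ T^[k] '' F m := ⟨k, h⟩
    rw [levelCode, dif_pos hx]
    congr 1
    by_contra hne
    exact Set.disjoint_left.1 (H.disjoint_levels m hx.choose k (Fin.is_lt _) k.is_lt
      fun h => hne (Fin.ext h)) hx.choose_spec h

lemma levelCode_eq_last_iff (m : ℕ) (x : X) :
    levelCode T (F m) (towerHeight q a m) x = Fin.last _ ↔
      x ∉ towerUnion T (F m) (towerHeight q a m) := by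
  have hiff : x ∈ towerUnion T (F m) (towerHeight q a m) ↔
      ∃ k : Fin (towerHeight q a m), x ∈ T^[k] '' F m :=
    ⟨fun ⟨k, hk, hx⟩ => ⟨⟨k, hk⟩, hx⟩, fun ⟨k, hx⟩ => ⟨k, k.is_lt, hx⟩⟩
  rw [hiff, levelCode]
  split_ifs with hx
  · simp only [hx, not_true_eq_false, iff_false]
    exact (Fin.castSucc_lt_last _).ne
  · simp only [hx, not_false_eq_true]

lemma measurable_levelCode (H : IsCutAndStack μ T q a F Fc C) (m : ℕ) :
    Measurable (levelCode T (F m) (towerHeight q a m)) := by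
  refine measurable_to_countable' fun y => ?_
  induction y using Fin.lastCases with
  | last =>
    convert (H.measurableSet_towerUnion m).compl using 1
    ext x
    exact levelCode_eq_last_iff m x
  | cast k =>
    convert H.measurableSet_level m k using 1
    ext x
    exact H.levelCode_eq_castSucc_iff k

/-- The partition into the levels of a tower is constant on each level of a later tower. -/
lemma exists_levelCode_eq (H : IsCutAndStack μ T q a F Fc C) {m n : ℕ} (hmn : m ≤ n) :
    ∃ σ : ℕ → Fin (towerHeight q a m + 1), ∀ k < towerHeight q a n, ∀ x ∈ T^[k] '' F n,
      levelCode T (F m) (towerHeight q a m) x = σ k := by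
  have : ∀ k, ∃ y : Fin (towerHeight q a m + 1), k < towerHeight q a n →
      ∀ x ∈ T^[k] '' F n, levelCode T (F m) (towerHeight q a m) x = y := by
    intro k
    by_cases hk : k < towerHeight q a n
    · rcases H.level_subset_or_disjoint hmn k hk with ⟨l, hl, h⟩ | h
      · exact ⟨Fin.castSucc ⟨l, hl⟩, fun _ x hx =>
          (H.levelCode_eq_castSucc_iff ⟨l, hl⟩).2 (h hx)⟩
      · exact ⟨Fin.last _, fun _ x hx =>
          (levelCode_eq_last_iff m x).2 (Set.disjoint_left.1 h hx)⟩
    · exact ⟨Fin.last _, fun h => absurd h hk⟩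
  choose σ hσ using this
  exact ⟨σ, hσ⟩

/-- A level of a tower contains at most a proportional number of levels of a later tower. -/
lemma card_filter_level_mul_le [IsFiniteMeasure μ] (H : IsCutAndStack μ T q a F Fc C)
    (hT : MeasurePreserving T μ μ) {m n : ℕ} {σ : ℕ → Fin (towerHeight q a m + 1)}
    (hσ : ∀ k < towerHeight q a n, ∀ x ∈ T^[k] '' F n,
      levelCode T (F m) (towerHeight q a m) x = σ k)
    {y : Fin (towerHeight q a m + 1)} (hy : y ≠ Fin.last _) :
    (Finset.filter (fun k => σ k = y) (Finset.range (towerHeight q a n))).card * μ.real (F n)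
      ≤ μ.real (F m) := by
  obtain ⟨l, rfl⟩ := Fin.exists_castSucc_eq.2 hy
  have h1 := H.measureReal_biUnion_level hT (n := n)
    (s := Finset.filter (fun k => σ k = l.castSucc) (Finset.range (towerHeight q a n)))
    (f := id) (fun i hi => by simpa using (Finset.mem_filter.1 hi).1) Function.injective_id.injOn
  rw [← h1, ← H.measureReal_level hT m l]
  refine measureReal_mono (Set.iUnion₂_subset fun k hk x hx => ?_)
  obtain ⟨hk, hkl⟩ := Finset.mem_filter.1 hk
  rw [← H.levelCode_eq_castSucc_iff, hσ k (Finset.mem_range.1 hk) x hx, hkl]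

end IsCutAndStack

/-! ### One stage of the construction -/

/-- The spacers of a stage. Consecutive groups of `L` columns form blocks, and `M` consecutive
blocks form a superblock. There are spacers only after the last column of a block: after the `j`-th block
of the `W`-th superblock, their number is the `j`-th base-`R` digit of `W`. -/
def digitSpacers (R L M i : ℕ) : ℕ :=
  if L ∣ i + 1 then i / L / M / R ^ (i / L % M) % R else 0

lemma digitSpacers_of_lt {R L M B r : ℕ} (hr : r + 1 < L) : digitSpacers R L M (B * L + r) = 0 := by
  rw [digitSpacers, if_neg]
  intro h
  have h1 : L ∣ r + 1 := by
    rw [add_assoc] at h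
    exact (Nat.dvd_add_right (dvd_mul_left L B)).1 h
  have := Nat.le_of_dvd (by omega) h1
  omega

lemma digitSpacers_last {R L M W j : ℕ} (hL : 0 < L) (hj : j < M) :
    digitSpacers R L M ((W * M + j) * L + (L - 1)) = W / R ^ j % R := by
  have h1 : ((W * M + j) * L + (L - 1)) / L = W * M + j := by
    rw [mul_comm, Nat.mul_add_div hL, Nat.div_eq_of_lt (by omega), add_zero]
  have h2 : (W * M + j) / M = W := by
    rw [mul_comm, Nat.mul_add_div (by omega), Nat.div_eq_of_lt hj, add_zero]
  have h3 : (W * M + j) % M = j := by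
    rw [mul_comm, Nat.mul_add_mod, Nat.mod_eq_of_lt hj]
  rw [digitSpacers, if_pos, h1, h2, h3]
  rw [add_assoc, Nat.sub_add_cancel hL]
  exact dvd_add (dvd_mul_left L _) dvd_rfl

lemma spacerTotal_digitSpacers_le {R L M q : ℕ} (hR : 0 < R) (hq : L ∣ q) :
    L * spacerTotal q (digitSpacers R L M) ≤ R * q := by
  have h1 : spacerTotal q (digitSpacers R L M) ≤
      ∑ i ∈ Finset.range q, if L ∣ i + 1 then R else 0 := by
    refine (Finset.sum_le_sum fun i _ => ?_).trans (Finset.sum_le_sum_of_subset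
      (Finset.range_mono (Nat.sub_le q 1)))
    rw [digitSpacers]
    split_ifs
    · exact (Nat.mod_lt _ hR).le
    · exact le_rfl
  rw [← Finset.sum_filter, Finset.sum_const, Nat.card_multiples, smul_eq_mul] at h1
  calc L * spacerTotal q (digitSpacers R L M) ≤ L * (q / L * R) := Nat.mul_le_mul_left L h1
    _ = L * (q / L) * R := by ring
    _ = R * q := by rw [Nat.mul_div_cancel' hq, mul_comm]

/-- The requirements on one stage: `R ^ M` superblocks of `M` blocks of `L` columns of height `h`;
the times `t k`, `k₀ ≤ k`, are at least two block lengths `L * h + R` apart, and the superblocks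
are much longer than the times `t k`, `k < 4 * N`. -/
structure IsStage (t : ℕ → ℕ) (h q : ℕ) (a : ℕ → ℕ) (R L M N k₀ : ℕ) : Prop where
  R_pos : 0 < R
  R_le : R ≤ h
  le_two_R : h ≤ 2 * R
  L_pos : 0 < L
  M_pos : 0 < M
  q_eq : q = R ^ M * (M * L)
  spacer_eq : ∀ i, a i = digitSpacers R L M i
  N_pos : 0 < N
  k₀_le : k₀ ≤ N
  start_le : L * h + R ≤ t k₀
  gap : ∀ k ≥ k₀, t k + 2 * (L * h + R) ≤ t (k + 1)
  last_le : 16 * t (4 * N - 1) ≤ M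

namespace IsCutAndStack

variable {X : Type*} [MeasurableSpace X] {μ : Measure X} {T : X ≃ᵐ X} {q : ℕ → ℕ}
  {a : ℕ → ℕ → ℕ} {F : ℕ → Set X} {Fc : ℕ → ℕ → Set X} {C : ℕ → ℕ → ℕ → Set X}
  {t : ℕ → ℕ} {m n R L M N k₀ : ℕ}

lemma image_of_spacers_eq_zero (H : IsCutAndStack μ T q a F Fc C) {i r : ℕ} (hi : i + r < q n)
    (ha : ∀ r' < r, a n (i + r') = 0) :
    T^[r * towerHeight q a n] '' Fc n i = Fc n (i + r) := by
  induction r with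
  | zero => simp
  | succ r ih =>
    have h1 := H.image_next_cut (n := n) (i := i + r) (by omega)
    rw [ha r (by omega), add_zero] at h1
    rw [Nat.succ_mul, add_comm, Function.iterate_add, Set.image_comp,
      ih (by omega) fun r' hr' => ha r' (by omega), h1]
    rfl

/-- Within a superblock, the orbit of a base point reads the name given by the digits of the
number of the superblock. -/
lemma levelCode_iterate_eq_blockName (H : IsCutAndStack μ T q a F Fc C) (hmn : m ≤ n)
    (hs : IsStage t (towerHeight q a n) (q n) (a n) R L M N k₀)
    {σ : ℕ → Fin (towerHeight q a m + 1)}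
    (hσ : ∀ k < towerHeight q a n, ∀ x ∈ T^[k] '' F n,
      levelCode T (F m) (towerHeight q a m) x = σ k)
    {W : ℕ} (hW : W < R ^ M) {d : ℕ} (hd : d ≤ M) {x : X}
    (hx : x ∈ Fc n ((W * M + (M - d)) * L)) {τ : ℕ} (hτ : τ < d * (L * towerHeight q a n)) :
    levelCode T (F m) (towerHeight q a m) (T^[τ] x) =
      blockName σ (Fin.last _) (towerHeight q a n) L R d (W / R ^ (M - d)) τ := by
  set h := towerHeight q a n with hh
  have hpos : 0 < h := towerHeight_pos (a := a) H.one_le_q n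
  have hL := hs.L_pos
  induction d generalizing x τ with
  | zero => simp at hτ
  | succ d ih =>
    obtain ⟨j, hj⟩ : ∃ j, M - (d + 1) = j := ⟨_, rfl⟩
    have hjM : j < M := by omega
    rw [hj] at hx ⊢
    have hblock : ∀ j', j' < M → (W * M + j') * L + L ≤ q n := by
      intro j' hj'
      calc (W * M + j') * L + L = (W * M + (j' + 1)) * L := by ring
        _ ≤ (W * M + M) * L := Nat.mul_le_mul_right _ (by omega)
        _ = (W + 1) * (M * L) := by ring
        _ ≤ R ^ M * (M * L) := Nat.mul_le_mul_right _ hW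
        _ = q n := hs.q_eq.symm
    have hcol : ∀ r < L, T^[r * h] x ∈ Fc n ((W * M + j) * L + r) := by
      intro r hr
      have hb := hblock j hjM
      have h1 := H.image_of_spacers_eq_zero (n := n) (i := (W * M + j) * L) (r := r) (by omega)
        fun r' hr' => by rw [hs.spacer_eq, digitSpacers_of_lt (by omega)]
      rw [← h1]
      exact ⟨x, hx, rfl⟩
    rw [blockName]
    split_ifs with h1 h2
    · have hr : τ / h < L := Nat.div_lt_of_lt_mul (by rwa [mul_comm] at h1)
      have hmem := hcol (τ / h) hr
      refine hσ (τ % h) (Nat.mod_lt _ hpos) _ ⟨_, H.cut_subset ?_ hmem, ?_⟩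
      · have hb := hblock j hjM
        omega
      · rw [← Function.iterate_add_apply, mul_comm, Nat.mod_add_div]
    · have hd0 : 0 < d := by
        rcases d.eq_zero_or_pos with rfl | hd0
        · simp at hτ
          omega
        · exact hd0
      have hb := hblock (j + 1) (by omega)
      have hb' : (W * M + (j + 1)) * L = (W * M + j) * L + L := by ring
      have hmem := hcol (L - 1) (by omega)
      have ha : a n ((W * M + j) * L + (L - 1)) = W / R ^ j % R := by
        rw [hs.spacer_eq, digitSpacers_last hL hjM]
      refine (levelCode_eq_last_iff m _).2 fun hmem' => ?_
      refine Set.disjoint_left.1 (H.disjoint_spacer_towerUnion (n := n)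
        (i := (W * M + j) * L + (L - 1)) (j := τ - L * h) (by omega) (by omega)) ?_
        (H.towerUnion_mono hmn hmem')
      rw [← H.image_spacer_level (by omega) (by omega)]
      refine ⟨_, hmem, ?_⟩
      have hLh : h + (L - 1) * h = L * h := by
        rw [Nat.sub_mul, one_mul]
        have := Nat.le_mul_of_pos_left h hL
        omega
      rw [← Function.iterate_add_apply]
      exact congrArg (fun k => T^[k] x) (by omega)
    · have hd0 : 0 < d := by
        rcases d.eq_zero_or_pos with rfl | hd0
        · simp at hτ
          omega
        · exact hd0
      have hb := hblock (j + 1) (by omega)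
      have hb' : (W * M + (j + 1)) * L = (W * M + j) * L + L := by ring
      have hmem := hcol (L - 1) (by omega)
      have ha : a n ((W * M + j) * L + (L - 1)) = W / R ^ j % R := by
        rw [hs.spacer_eq, digitSpacers_last hL hjM]
      have hLh : h + (L - 1) * h = L * h := by
        rw [Nat.sub_mul, one_mul]
        have := Nat.le_mul_of_pos_left h hL
        omega
      have hMd : M - d = j + 1 := by omega
      have hnext : T^[L * h + W / R ^ j % R] x ∈ Fc n ((W * M + (M - d)) * L) := by
        have h3 := H.image_next_cut (n := n) (i := (W * M + j) * L + (L - 1)) (by omega)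
        rw [ha, ← hh] at h3
        rw [hMd, hb', show (W * M + j) * L + L = (W * M + j) * L + (L - 1) + 1 by omega, ← h3]
        refine ⟨_, hmem, ?_⟩
        rw [← Function.iterate_add_apply]
        exact congrArg (fun k => T^[k] x) (by omega)
      rw [Nat.succ_mul] at hτ
      have h4 := ih (by omega) hnext (τ := τ - (L * h + W / R ^ j % R)) (by omega)
      rw [← Function.iterate_add_apply, Nat.sub_add_cancel (by omega)] at h4
      rw [h4, hMd, pow_succ, Nat.div_div_eq_div_mul]

end IsCutAndStack

/-! ### Entropy at a stage -/

namespace IsCutAndStack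

variable {X : Type*} [MeasurableSpace X] {μ : Measure X} {T : X ≃ᵐ X} {q : ℕ → ℕ}
  {a : ℕ → ℕ → ℕ} {F : ℕ → Set X} {Fc : ℕ → ℕ → Set X} {C : ℕ → ℕ → ℕ → Set X}
  {t : ℕ → ℕ} {m n R L M N k₀ : ℕ}

lemma columnStart_add_mul_le (q : ℕ → ℕ) (a : ℕ → ℕ → ℕ) (n i j : ℕ) :
    columnStart q a n i + j * towerHeight q a n ≤ columnStart q a n (i + j) := by
  induction j with
  | zero => simp
  | succ j ih =>
    rw [← add_assoc i, columnStart_succ, Nat.succ_mul]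
    omega

/-- The points at one of the first `P` positions of a superblock, as a union of levels of the next
tower, indexed by the position in the superblock and the number of the superblock. -/
def earlySet (T : X ≃ᵐ X) (q : ℕ → ℕ) (a : ℕ → ℕ → ℕ) (F : ℕ → Set X) (n R L M P : ℕ) : Set X :=
  ⋃ i ∈ Finset.range P ×ˢ Finset.range (R ^ M),
    T^[columnStart q a n (i.2 * (M * L)) + i.1] '' F (n + 1)

lemma superblock_level_lt (H : IsCutAndStack μ T q a F Fc C) (hq : q n = R ^ M * (M * L)) {W p : ℕ}
    (hW : W < R ^ M) (hp : p < M * L * towerHeight q a n) :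
    columnStart q a n (W * (M * L)) + p < towerHeight q a (n + 1) := by
  have hpos := towerHeight_pos (a := a) H.one_le_q n
  have h1 : p / towerHeight q a n < M * L := Nat.div_lt_of_lt_mul (by rwa [mul_comm] at hp)
  have h2 : W * (M * L) + p / towerHeight q a n < q n := by
    have : (W + 1) * (M * L) ≤ R ^ M * (M * L) := Nat.mul_le_mul_right _ hW
    rw [Nat.succ_mul] at this
    omega
  have h3 := H.columnStart_add_lt h2 (Nat.mod_lt p hpos)
  have h4 := columnStart_add_mul_le q a n (W * (M * L)) (p / towerHeight q a n)
  have h5 := Nat.div_add_mod' p (towerHeight q a n)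
  omega

lemma measureReal_earlySet [IsFiniteMeasure μ] (H : IsCutAndStack μ T q a F Fc C)
    (hT : MeasurePreserving T μ μ) (hq : q n = R ^ M * (M * L)) {P : ℕ}
    (hP : P ≤ M * L * towerHeight q a n) :
    μ.real (earlySet T q a F n R L M P) = (P * R ^ M : ℕ) * μ.real (F (n + 1)) := by
  rw [earlySet, H.measureReal_biUnion_level hT (n := n + 1)
    (f := fun i : ℕ × ℕ => columnStart q a n (i.2 * (M * L)) + i.1)]
  · rw [Finset.card_product, Finset.card_range, Finset.card_range]
  · rintro ⟨p, W⟩ hi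
    simp only [Finset.mem_product, Finset.mem_range] at hi
    exact H.superblock_level_lt hq hi.2 (by omega)
  · have key : ∀ p W p' W', p < P → W < W' →
        columnStart q a n (W * (M * L)) + p < columnStart q a n (W' * (M * L)) + p' := by
      intro p W p' W' hp hW
      have h1 := columnStart_add_mul_le q a n (W * (M * L)) (M * L)
      have h2 := columnStart_add_mul_le q a n (W * (M * L) + M * L) ((W' - (W + 1)) * (M * L))
      have h3 : W * (M * L) + M * L + (W' - (W + 1)) * (M * L) = W' * (M * L) := by
        obtain ⟨d, rfl⟩ := Nat.exists_eq_add_of_lt hW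
        rw [show W + d + 1 - (W + 1) = d by omega]
        ring
      rw [h3] at h2
      have h4 := Nat.zero_le ((W' - (W + 1)) * (M * L) * towerHeight q a n)
      omega
    rintro ⟨p, W⟩ hi ⟨p', W'⟩ hi' heq
    simp only [Finset.coe_product, Finset.coe_range, Set.mem_prod, Set.mem_Iio] at hi hi' heq
    rcases lt_trichotomy W W' with hlt | rfl | hlt
    · exact absurd heq (key p W p' W' hi.1 hlt).ne
    · rw [Nat.add_left_cancel heq]
    · exact absurd heq (key p' W' p W hi'.1 hlt).ne'

/-- Averaged over a window of spacer lengths, a level of the tower of height `h_m` is seen with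
frequency at most `8 / h_m`: it contains at most about `h / h_m` levels of the tower of height `h`,
a window shows each of them at most twice, and `h ≤ 2 * R`. -/
lemma window_le [IsProbabilityMeasure μ] (H : IsCutAndStack μ T q a F Fc C)
    (hT : MeasurePreserving T μ μ)
    (hn : 15 / 16 ≤ μ.real (towerUnion T (F n) (towerHeight q a n)))
    (hs : IsStage t (towerHeight q a n) (q n) (a n) R L M N k₀)
    {σ : ℕ → Fin (towerHeight q a m + 1)}
    (hσ : ∀ k < towerHeight q a n, ∀ x ∈ T^[k] '' F n,
      levelCode T (F m) (towerHeight q a m) x = σ k)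
    (y : Fin (towerHeight q a m + 1)) (M' W x : ℕ) (hx : R ≤ x + 1) :
    ((Finset.filter (fun s => blockName σ (Fin.last _) (towerHeight q a n) L R M' W (x - s) = y)
      (Finset.range R)).card : ℝ) ≤
      R * if y = Fin.last _ then 1 else 8 / (towerHeight q a m : ℝ) := by
  split_ifs with hy
  · rw [mul_one]
    exact_mod_cast (Finset.card_filter_le _ _).trans (Finset.card_range R).le
  · have h1 := card_window_blockName_le (σ := σ) (y := y) le_rfl hy
      (towerHeight_pos (a := a) H.one_le_q n) hs.L_pos hs.R_le M' W x hx
    have h2 := H.card_filter_level_mul_le hT hσ hy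
    set κ := (Finset.filter (fun k => σ k = y) (Finset.range (towerHeight q a n))).card
    have h3 : (towerHeight q a m : ℝ) * μ.real (F m) ≤ 1 := by
      rw [← H.measureReal_towerUnion hT]
      exact measureReal_le_one
    rw [H.measureReal_towerUnion hT] at hn
    have h4 : (towerHeight q a n : ℝ) ≤ 2 * R := by exact_mod_cast hs.le_two_R
    have hm : (0 : ℝ) < towerHeight q a m := by
      exact_mod_cast towerHeight_pos (a := a) H.one_le_q m
    have hn' : (0 : ℝ) < towerHeight q a n := by
      exact_mod_cast towerHeight_pos (a := a) H.one_le_q n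
    have h5 : (κ : ℝ) * towerHeight q a m * (15 / 16) ≤ towerHeight q a n := by
      calc (κ : ℝ) * towerHeight q a m * (15 / 16)
          ≤ κ * towerHeight q a m * (towerHeight q a n * μ.real (F n)) := by gcongr
        _ = towerHeight q a n * (towerHeight q a m * (κ * μ.real (F n))) := by ring
        _ ≤ towerHeight q a n * (towerHeight q a m * μ.real (F m)) := by gcongr
        _ ≤ towerHeight q a n * 1 := by gcongr
        _ = towerHeight q a n := mul_one _
    have h6 : ((Finset.filter (fun s => blockName σ (Fin.last _) (towerHeight q a n) L R M' W
        (x - s) = y) (Finset.range R)).card : ℝ) ≤ 2 * κ := by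
      exact_mod_cast h1
    refine h6.trans ?_
    rw [mul_div_assoc', le_div_iff₀ hm]
    nlinarith

/-- The number of indices `k < 4 * N` for which the orbit is outside `A` at the time `t k`. -/
def missCount (T : X → X) (t : ℕ → ℕ) (A : Set X) (N : ℕ) (x : X) : ℝ :=
  ∑ k ∈ Finset.range (4 * N), Aᶜ.indicator (fun _ => (1 : ℝ)) (T^[t k] x)

lemma measurable_missCount (hT : Measurable T) {A : Set X} (hA : MeasurableSet A) :
    Measurable (missCount T t A N) :=
  Finset.measurable_sum _ fun k _ =>
    (measurable_const.indicator hA.compl).comp (hT.iterate (t k))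

lemma measureReal_missCount_ge_le [IsProbabilityMeasure μ] (hT : MeasurePreserving T μ μ)
    {A : Set X} (hA : MeasurableSet A) (hμ : 15 / 16 ≤ μ.real A) (hN : 0 < N) :
    μ.real {x | (2 * N : ℝ) ≤ missCount T t A N x} ≤ 1 / 8 := by
  have hint : ∀ k, Integrable (fun x => Aᶜ.indicator (fun _ => (1 : ℝ)) (T^[t k] x)) μ := fun k =>
    ((hT.iterate (t k)).integrable_comp_of_integrable
      ((integrable_const (1 : ℝ)).indicator hA.compl))
  have h1 : ∫ x, missCount T t A N x ∂μ ≤ N / 4 := by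
    simp only [missCount]
    rw [integral_finsetSum _ fun k _ => hint k]
    have h2 : ∀ k ∈ Finset.range (4 * N),
        ∫ x, Aᶜ.indicator (fun _ => (1 : ℝ)) (T^[t k] x) ∂μ ≤ 1 / 16 := by
      intro k _
      have h3 : (fun x => Aᶜ.indicator (fun _ => (1 : ℝ)) (T^[t k] x)) =
          (T^[t k] ⁻¹' Aᶜ).indicator 1 := by
        funext x
        rfl
      rw [h3, integral_indicator_one ((hT.iterate (t k)).measurable hA.compl), Measure.real,
        (hT.iterate (t k)).measure_preimage hA.compl.nullMeasurableSet]
      have := probReal_compl_eq_one_sub (μ := μ) hA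
      rw [Measure.real] at this
      linarith
    refine (Finset.sum_le_sum h2).trans (le_of_eq ?_)
    rw [Finset.sum_const, Finset.card_range, nsmul_eq_mul]
    push_cast
    ring
  have h4 := mul_meas_ge_le_integral_of_nonneg (μ := μ) (f := missCount T t A N)
    (Eventually.of_forall fun x => Finset.sum_nonneg fun k _ =>
      Set.indicator_nonneg (fun _ _ => zero_le_one) _)
    (integrable_finsetSum _ fun k _ => hint k) (2 * N)
  have hN' : (0 : ℝ) < N := by exact_mod_cast hN
  have h5 := h4.trans h1
  nlinarith

/-- Each name along the times `t k`, `k < 4 * N`, that has few symbols for the complement of the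
tower has small measure on the early part of the superblocks. -/
lemma measureReal_name_le [IsProbabilityMeasure μ] (H : IsCutAndStack μ T q a F Fc C)
    (hT : MeasurePreserving T μ μ) (hmn : m ≤ n)
    (hn : 15 / 16 ≤ μ.real (towerUnion T (F n) (towerHeight q a n)))
    (hm : 16 ≤ towerHeight q a m)
    (hs : IsStage t (towerHeight q a n) (q n) (a n) R L M N k₀)
    (w : Fin (4 * N) → Fin (towerHeight q a m + 1)) :
    μ.real ((earlySet T q a F n R L M (M * L * towerHeight q a n - t (4 * N - 1)) ∩
      {x | missCount T t (towerUnion T (F m) (towerHeight q a m)) N x < 2 * N}) ∩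
      sequenceCoding T t (levelCode T (F m) (towerHeight q a m)) (4 * N) ⁻¹' {w}) ≤
      (8 / (towerHeight q a m : ℝ)) ^ N := by
  obtain ⟨σ, hσ⟩ := H.exists_levelCode_eq hmn
  set A := towerUnion T (F m) (towerHeight q a m)
  set θ := 8 / (towerHeight q a m : ℝ) with hθ
  have hm' : (16 : ℝ) ≤ towerHeight q a m := by exact_mod_cast hm
  have hθ0 : 0 ≤ θ := by positivity
  have hθ1 : θ ≤ 1 := by
    rw [hθ, div_le_one (by linarith)]
    linarith
  set P := M * L * towerHeight q a n - t (4 * N - 1) with hP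
  let w' : ℕ → Fin (towerHeight q a m + 1) := fun k =>
    if hk : k < 4 * N then w ⟨k, hk⟩ else Fin.last _
  let β : Fin (towerHeight q a m + 1) → ℝ := fun y => if y = Fin.last _ then 1 else θ
  have hβ : ∀ y, 0 ≤ β y := fun y => by
    simp only [β]
    split_ifs <;> linarith
  have hword : ∀ x, sequenceCoding T t (levelCode T (F m) (towerHeight q a m)) (4 * N) x = w →
      ∀ k < 4 * N, levelCode T (F m) (towerHeight q a m) (T^[t k] x) = w' k := by
    intro x hx k hk
    simp only [w', hk, dif_pos]
    rw [← hx]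
    rfl
  rcases Set.eq_empty_or_nonempty ((earlySet T q a F n R L M P ∩
      {x | missCount T t A N x < 2 * N}) ∩
      sequenceCoding T t (levelCode T (F m) (towerHeight q a m)) (4 * N) ⁻¹' {w}) with
    hemp | ⟨x₀, ⟨-, hx₀⟩, hw₀⟩
  · rw [hemp, measureReal_empty]
    positivity
  -- at least `N` of the times after `k₀` show a level of the tower
  have hprod : ∏ k ∈ Finset.Ico k₀ (4 * N), β (w' k) ≤ θ ^ N := by
    have h1 : missCount T t A N x₀ =
        (Finset.filter (fun k => w' k = Fin.last _) (Finset.range (4 * N))).card := by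
      rw [missCount, ← Finset.sum_boole]
      refine Finset.sum_congr rfl fun k hk => ?_
      have hiff : w' k = Fin.last _ ↔ T^[t k] x₀ ∈ Aᶜ := by
        rw [← hword x₀ hw₀ k (Finset.mem_range.1 hk), levelCode_eq_last_iff]
        rfl
      by_cases hk' : T^[t k] x₀ ∈ Aᶜ
      · rw [Set.indicator_of_mem hk', if_pos (hiff.2 hk')]
      · rw [Set.indicator_of_notMem hk', if_neg fun h => hk' (hiff.1 h)]
    have h2 : (Finset.filter (fun k => w' k = Fin.last _) (Finset.range (4 * N))).card
        < 2 * N := by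
      have : missCount T t A N x₀ < 2 * N := hx₀
      rw [h1] at this
      exact_mod_cast this
    have h3 : (Finset.filter (fun k => w' k = Fin.last _) (Finset.Ico k₀ (4 * N))).card ≤
        (Finset.filter (fun k => w' k = Fin.last _) (Finset.range (4 * N))).card :=
      Finset.card_le_card (Finset.filter_subset_filter _ fun k hk => by
        simp only [Finset.mem_Ico, Finset.mem_range] at hk ⊢
        omega)
    have h4 := Finset.card_filter_add_card_filter_not (s := Finset.Ico k₀ (4 * N))
      (fun k => w' k = Fin.last _)
    rw [Nat.card_Ico] at h4
    have h5 := hs.k₀_le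
    simp only [β]
    rw [Finset.prod_ite, Finset.prod_const_one, one_mul, Finset.prod_const]
    exact pow_le_pow_of_le_one hθ0 hθ1 (by omega)
  have hmono : ∀ k ≥ k₀, ∀ k' ≥ k, t k ≤ t k' := by
    intro k hk k' hk'
    induction k', hk' using Nat.le_induction with
    | base => rfl
    | succ k' hk' ih => have := hs.gap k' (by omega); omega
  have hcount : ∀ p ∈ Finset.range P, matchCount σ (Fin.last _) (towerHeight q a n) L R (4 * N)
      (fun k => p + t k) w' M k₀ 0 ≤ (R : ℝ) ^ M * θ ^ N := by
    intro p hp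
    rw [Finset.mem_range] at hp
    refine (tailBound hβ hs.R_pos (H.window_le hT hn hs hσ) (u := fun k => p + t k) ?_ ?_ M 0
      ?_ ?_).trans (by gcongr)
    · intro k hk
      have := hs.gap k hk
      omega
    · have := hs.k₀_le
      omega
    · intro _
      have := hs.start_le
      simp only
      omega
    · intro k h1 h2
      have := hmono k h1 (4 * N - 1) (by omega)
      rw [← mul_assoc]
      simp only
      omega
  rw [earlySet, Set.inter_assoc, Set.iUnion₂_inter]
  refine (measureReal_biUnion_finset_le _ _).trans ?_
  have hterm : ∀ i ∈ Finset.range P ×ˢ Finset.range (R ^ M),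
      μ.real (T^[columnStart q a n (i.2 * (M * L)) + i.1] '' F (n + 1) ∩
        ({x | missCount T t A N x < 2 * N} ∩
        sequenceCoding T t (levelCode T (F m) (towerHeight q a m)) (4 * N) ⁻¹' {w})) ≤
      μ.real (F (n + 1)) * if ∀ k, k₀ ≤ k → k < 4 * N →
        blockName σ (Fin.last _) (towerHeight q a n) L R M i.2 (i.1 + t k - 0) = w' k
        then 1 else 0 := by
    rintro ⟨p, W⟩ hi
    simp only [Finset.mem_product, Finset.mem_range] at hi
    obtain ⟨hp, hW⟩ := hi
    split_ifs with hmatch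
    · rw [mul_one, ← H.measureReal_level hT (n + 1) (columnStart q a n (W * (M * L)) + p)]
      exact measureReal_mono Set.inter_subset_left
    · rw [mul_zero]
      refine le_of_eq ?_
      convert measureReal_empty (μ := μ)
      refine Set.eq_empty_of_forall_notMem ?_
      rintro x ⟨hx, -, hxw⟩
      refine hmatch fun k h1 h2 => ?_
      have hWq : W * (M * L) < q n := by
        rw [hs.q_eq]
        exact Nat.mul_lt_mul_of_pos_right hW (Nat.mul_pos hs.M_pos hs.L_pos)
      rw [H.image_columnStart_add hWq] at hx
      obtain ⟨y, hy, rfl⟩ := hx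
      have h3 := hmono k h1 (4 * N - 1) (by omega)
      have h4 := H.levelCode_iterate_eq_blockName hmn hs hσ hW (le_refl M) (x := y)
        (by rw [Nat.sub_self, add_zero, mul_assoc]; exact hy) (τ := p + t k)
        (by rw [← mul_assoc]; omega)
      rw [Nat.sub_self, pow_zero, Nat.div_one] at h4
      rw [Nat.sub_zero, ← hword _ hxw k h2, ← h4, ← Function.iterate_add_apply,
        add_comm p (t k)]
  refine (Finset.sum_le_sum hterm).trans ?_
  rw [← Finset.mul_sum, Finset.sum_product]
  have hearly := H.measureReal_earlySet hT hs.q_eq (P := P) (Nat.sub_le _ _)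
  have hle1 : μ.real (earlySet T q a F n R L M P) ≤ 1 := measureReal_le_one
  rw [hearly] at hle1
  push_cast at hle1
  calc μ.real (F (n + 1)) * ∑ p ∈ Finset.range P,
        matchCount σ (Fin.last _) (towerHeight q a n) L R (4 * N) (fun k => p + t k) w' M k₀ 0
      ≤ μ.real (F (n + 1)) * ∑ p ∈ Finset.range P, (R : ℝ) ^ M * θ ^ N := by
        gcongr with p hp
        exact hcount p hp
    _ = P * R ^ M * μ.real (F (n + 1)) * θ ^ N := by
        rw [Finset.sum_const, Finset.card_range, nsmul_eq_mul]
        ring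
    _ ≤ 1 * θ ^ N := by gcongr
    _ = θ ^ N := one_mul _

/-- At a stage, the entropy of the names along the first `4 * N` times is of order `N`. -/
lemma le_shannonEntropy_of_isStage [IsProbabilityMeasure μ] (H : IsCutAndStack μ T q a F Fc C)
    (hT : MeasurePreserving T μ μ) (hmn : m ≤ n)
    (hm1 : 15 / 16 ≤ μ.real (towerUnion T (F m) (towerHeight q a m)))
    (hm : 16 ≤ towerHeight q a m)
    (hs : IsStage t (towerHeight q a n) (q n) (a n) R L M N k₀) :
    N / 2 * Real.log (towerHeight q a m / 16) ≤
      shannonEntropy μ (sequenceCoding T t (levelCode T (F m) (towerHeight q a m)) (4 * N)) := by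
  have hn : 15 / 16 ≤ μ.real (towerUnion T (F n) (towerHeight q a n)) :=
    hm1.trans (measureReal_mono (H.towerUnion_mono hmn))
  have hAm := H.measurableSet_towerUnion m
  set A := towerUnion T (F m) (towerHeight q a m)
  set h := towerHeight q a n with hh
  set P := M * L * h - t (4 * N - 1) with hP
  have hpos : 0 < h := towerHeight_pos (a := a) H.one_le_q n
  have hm' : (16 : ℝ) ≤ towerHeight q a m := by exact_mod_cast hm
  have hearlym : MeasurableSet (earlySet T q a F n R L M P) :=
    Finset.measurableSet_biUnion _ fun i _ => H.measurableSet_level _ _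
  have hmiss : MeasurableSet {x | missCount T t A N x < 2 * N} :=
    measurableSet_lt (measurable_missCount T.measurable hAm) measurable_const
  have hcode : Measurable
      (sequenceCoding T t (levelCode T (F m) (towerHeight q a m)) (4 * N)) :=
    measurable_pi_lambda _ fun k => (H.measurable_levelCode m).comp (T.measurable.iterate _)
  have hearly : 7 / 8 ≤ μ.real (earlySet T q a F n R L M P) := by
    rw [H.measureReal_earlySet hT hs.q_eq (Nat.sub_le _ _)]
    have h1 := H.measureReal_base_succ hT n
    rw [H.measureReal_towerUnion hT, h1, hs.q_eq] at hn
    have hMLh : M ≤ M * L * h := by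
      rw [mul_assoc]
      exact Nat.le_mul_of_pos_right M (Nat.mul_pos hs.L_pos hpos)
    have h2 : 15 * (M * L * h) ≤ 16 * P := by
      have := hs.last_le
      omega
    have h3 : 15 * ((M : ℝ) * L * h) ≤ 16 * P := by exact_mod_cast h2
    push_cast at hn ⊢
    have h4 : (0 : ℝ) ≤ (R : ℝ) ^ M * μ.real (F (n + 1)) := by positivity
    nlinarith [mul_le_mul_of_nonneg_right h3 h4]
  have hG : 3 / 4 ≤ μ.real (earlySet T q a F n R L M P ∩ {x | missCount T t A N x < 2 * N}) := by
    have h1 := measureReal_missCount_ge_le (t := t) hT hAm hm1 hs.N_pos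
    have h2 : earlySet T q a F n R L M P ⊆
        (earlySet T q a F n R L M P ∩ {x | missCount T t A N x < 2 * N}) ∪
          {x | (2 * N : ℝ) ≤ missCount T t A N x} := by
      intro x hx
      rcases lt_or_ge (missCount T t A N x) (2 * N) with hlt | hge
      · exact Or.inl ⟨hx, hlt⟩
      · exact Or.inr hge
    have h3 := (measureReal_mono h2).trans (measureReal_union_le (μ := μ) _ _)
    linarith
  set θ := 8 / (towerHeight q a m : ℝ) with hθ
  have hθ0 : 0 < θ := by positivity
  have hθ2 : 2 * θ ≤ 1 := by
    rw [hθ, mul_div_assoc', div_le_one (by linarith)]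
    linarith
  have hpow : 2 * θ ^ N ≤ (2 * θ) ^ N := by
    rw [mul_pow]
    gcongr
    exact le_self_pow₀ one_le_two hs.N_pos.ne'
  have hent := le_shannonEntropy (μ := μ) (fun w => hcode (measurableSet_singleton w))
    (hearlym.inter hmiss) (hpow.trans (pow_le_one₀ (by positivity) hθ2))
    (H.measureReal_name_le hT hmn hn hm hs)
  have hlog : N * Real.log (towerHeight q a m / 16) ≤ -Real.log (2 * θ ^ N) := by
    have h1 := Real.log_le_log (by positivity) hpow
    have h2 : 2 * θ = ((towerHeight q a m : ℝ) / 16)⁻¹ := by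
      rw [hθ]
      field_simp
      norm_num
    rw [Real.log_pow, h2, Real.log_inv] at h1
    linarith
  have hlog0 : 0 ≤ Real.log ((towerHeight q a m : ℝ) / 16) :=
    Real.log_nonneg (by rw [le_div_iff₀ (by norm_num)]; linarith)
  have hN0 : (0 : ℝ) ≤ N := Nat.cast_nonneg _
  have h5 : 0 ≤ N * Real.log ((towerHeight q a m : ℝ) / 16) := mul_nonneg hN0 hlog0
  refine le_trans ?_ hent
  nlinarith

end IsCutAndStack

/-! ### Infinite sequence entropy -/

lemma two_pow_le_towerHeight {q : ℕ → ℕ} {a : ℕ → ℕ → ℕ} (hq : ∀ n, 2 ≤ q n) (n : ℕ) :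
    2 ^ n ≤ towerHeight q a n := by
  induction n with
  | zero => exact le_rfl
  | succ n ih =>
    rw [towerHeight, pow_succ']
    have := Nat.mul_le_mul (hq n) ih
    omega

/-- If every stage has the required form, the partitions into the levels of the towers have
arbitrarily large sequence entropy. -/
lemma IsCutAndStack.sequenceEntropy_eq_top {X : Type*} [MeasurableSpace X] {μ : Measure X}
    [IsProbabilityMeasure μ] {T : X ≃ᵐ X} {q : ℕ → ℕ} {a : ℕ → ℕ → ℕ} {F : ℕ → Set X}
    {Fc : ℕ → ℕ → Set X} {C : ℕ → ℕ → ℕ → Set X} (H : IsCutAndStack μ T q a F Fc C)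
    (hT : MeasurePreserving T μ μ) (hq : ∀ n, 2 ≤ q n) {t : ℕ → ℕ}
    (hstage : ∀ n, ∃ R L M N k₀, n ≤ N ∧
      IsStage t (towerHeight q a n) (q n) (a n) R L M N k₀) :
    sequenceEntropy μ T t = ⊤ := by
  refine EReal.eq_top_iff_forall_lt _ |>.2 fun c => ?_
  have hh : Tendsto (fun m => (towerHeight q a m : ℝ)) atTop atTop :=
    tendsto_atTop_mono (fun m => by exact_mod_cast two_pow_le_towerHeight hq m)
      (tendsto_pow_atTop_atTop_of_one_lt (one_lt_two : (1 : ℝ) < 2))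
  have hlog : Tendsto (fun m => Real.log ((towerHeight q a m : ℝ) / 16)) atTop atTop :=
    Real.tendsto_log_atTop.comp (hh.atTop_div_const (by norm_num))
  obtain ⟨m, hm1, hm2, hm3⟩ := ((H.tendsto_measureReal_towerUnion.eventually
    (lt_mem_nhds (show (15 / 16 : ℝ) < 1 by norm_num))).and
    ((hh.eventually_ge_atTop 16).and (hlog.eventually_ge_atTop (8 * (c + 1))))).exists
  have hm2' : 16 ≤ towerHeight q a m := by exact_mod_cast hm2
  have hlim : ((c + 1 : ℝ) : EReal) ≤
      sequenceEntropyOf μ T t (levelCode T (F m) (towerHeight q a m)) := by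
    refine le_limsup_of_frequently_le' ?_
    rw [frequently_atTop]
    intro n₀
    obtain ⟨R, L, M, N, k₀, hN, hs⟩ := hstage (max m n₀)
    refine ⟨4 * N, by have := le_max_right m n₀; omega, ?_⟩
    have h1 := H.le_shannonEntropy_of_isStage hT (le_max_left m n₀) hm1.le hm2' hs
    have hN0 : (0 : ℝ) < N := by exact_mod_cast hs.N_pos
    refine EReal.coe_le_coe_iff.2 ?_
    rw [one_div, inv_mul_eq_div, le_div_iff₀ (by push_cast; linarith)]
    refine le_trans ?_ h1
    push_cast
    nlinarith
  refine lt_of_lt_of_le (EReal.coe_lt_coe_iff.2 (lt_add_one c)) (hlim.trans ?_)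
  exact le_iSup_of_le _ (le_iSup_of_le _ (le_iSup_of_le (H.measurable_levelCode m) le_rfl))

/-- Given the height `h` of the tower of index `n`, there is a stage with a power of two as the
number of columns and few spacers. -/
lemma exists_isStage {t : ℕ → ℕ} (ht : DilatesToInfinity t) (n h : ℕ) (hh : 0 < h) :
    ∃ (b : ℕ) (a : ℕ → ℕ), 1 ≤ b ∧ 2 ^ n * spacerTotal (2 ^ b) a ≤ 2 ^ b ∧
      ∃ R L M N k₀, n ≤ N ∧ IsStage t h (2 ^ b) a R L M N k₀ := by
  -- the largest power of two up to `h` as the number of spacer lengths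
  obtain ⟨e, he⟩ : ∃ e, e = Nat.log 2 h := ⟨_, rfl⟩
  have hR1 : 2 ^ e ≤ h := he ▸ Nat.pow_log_le_self 2 hh.ne'
  have hR2 : h < 2 ^ (e + 1) := he ▸ Nat.lt_pow_succ_log_self one_lt_two h
  set L := 2 ^ e * 2 ^ (n + 1) with hL
  have hgap := ht.eventually_ge_atTop ((2 * (L * h + 2 ^ e) : ℕ) : ℤ)
  obtain ⟨k₁, hk₁⟩ := eventually_atTop.1 hgap
  have hk₁' : ∀ k ≥ k₁, t k + 2 * (L * h + 2 ^ e) ≤ t (k + 1) := by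
    intro k hk
    have := hk₁ k hk
    omega
  set N := k₁ + n + 1 with hN
  obtain ⟨s, hs⟩ : ∃ s, s = t (4 * N - 1) + 4 := ⟨_, rfl⟩
  set M := 2 ^ s with hM
  have hq : 2 ^ (e * M + (s + (e + (n + 1)))) = (2 ^ e) ^ M * (M * L) := by
    rw [pow_add, pow_add, pow_add, pow_mul]
  refine ⟨e * M + (s + (e + (n + 1))), digitSpacers (2 ^ e) L M, by omega, ?_, 2 ^ e, L, M, N,
    k₁ + 1, by omega, ?_⟩
  · have h1 := spacerTotal_digitSpacers_le (R := 2 ^ e) (L := L) (M := M)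
      (q := 2 ^ (e * M + (s + (e + (n + 1))))) (by positivity)
      (by rw [hq]; exact dvd_mul_of_dvd_right (dvd_mul_left L M) _)
    set S := spacerTotal (2 ^ (e * M + (s + (e + (n + 1))))) (digitSpacers (2 ^ e) L M)
    rw [hL, mul_assoc] at h1
    have h2 := Nat.le_of_mul_le_mul_left h1 (by positivity)
    refine le_trans (Nat.mul_le_mul_right S ?_) h2
    exact Nat.pow_le_pow_right (by norm_num) (by omega)
  · refine ⟨by positivity, hR1, ?_, by positivity, by positivity, hq, fun _ => rfl, by omega,
      by omega, ?_, fun k hk => hk₁' k (by omega), ?_⟩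
    · rw [pow_succ] at hR2
      omega
    · have := hk₁' k₁ le_rfl
      omega
    · have h1 : t (4 * N - 1) < 2 ^ t (4 * N - 1) := Nat.lt_two_pow_self
      rw [hM, hs, pow_add]
      omega

theorem mainTheorem1 (t : ℕ → ℕ) (ht : DilatesToInfinity t) :
    ∃ (X : Type) (_ : MeasurableSpace X) (_ : StandardBorelSpace X)
      (μ : MeasureTheory.Measure X) (_ : MeasureTheory.IsProbabilityMeasure μ) (T : X ≃ᵐ X),
      IsRankOne μ T ∧ sequenceEntropy μ T t = ⊤ := by
  have hstage := exists_isStage ht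
  choose! bf af hb1 hsp hst using hstage
  -- the data of a stage depend on its index and on the height reached so far
  let height : ℕ → ℕ := fun n => Nat.rec 1
    (fun n h => 2 ^ bf n h * h + spacerTotal (2 ^ bf n h) (af n h)) n
  let b : ℕ → ℕ := fun n => bf n (height n)
  let a : ℕ → ℕ → ℕ := fun n => af n (height n)
  have hheight : ∀ n, towerHeight (fun n => 2 ^ b n) a n = height n := by
    intro n
    induction n with
    | zero => rfl
    | succ n ih =>
      rw [towerHeight, ih]
  have hpos : ∀ n, 0 < height n := fun n => by
    rw [← hheight n]
    exact towerHeight_pos (fun n => Nat.one_le_two_pow) n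
  have hb : ∀ n, 1 ≤ b n := fun n => hb1 n (height n) (hpos n)
  have hsum : Summable fun n =>
      (spacerTotal (2 ^ b n) (a n) : ℝ) / 2 ^ Odometer.expo b (n + 1) := by
    refine Summable.of_nonneg_of_le (fun n => by positivity) (fun n => ?_)
      (summable_geometric_two)
    have h1 : 2 ^ n * spacerTotal (2 ^ b n) (a n) ≤ 2 ^ Odometer.expo b (n + 1) :=
      (hsp n (height n) (hpos n)).trans
        (Nat.pow_le_pow_right (by norm_num) (by rw [Odometer.expo_succ]; exact Nat.le_add_left _ _))
    have h2 : (2 : ℝ) ^ n * spacerTotal (2 ^ b n) (a n) ≤ 2 ^ Odometer.expo b (n + 1) := by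
      exact_mod_cast h1
    rw [one_div, inv_pow, div_le_iff₀ (by positivity), inv_mul_eq_div,
      le_div_iff₀ (by positivity), mul_comm]
    exact h2
  obtain ⟨X, _, hX, μ, hμ, T, hT, F, Fc, C, H⟩ :=
    Odometer.exists_isCutAndStack (b := b) (a := a) hb hsum
  refine ⟨X, _, hX, μ, hμ, T, ⟨hT, _, _, F, Fc, C, H⟩, ?_⟩
  refine H.sequenceEntropy_eq_top hT (fun n => ?_) fun n => ?_
  · exact Nat.le_self_pow (by have := hb n; omega) 2
  · rw [hheight n]
    exact hst n (height n) (hpos n)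

end
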